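/- Let $M$ be a topological manifold (Hausdorff, second countable, locally homeomorphic to $\mathbb R^m$; $M$ need not be compact, connected or orientable). For a singular homology class $\alpha\in H_k(M;\mathbb R)$ let $$\|\alpha\|_1=\inf\Big\{\sum_{j=1}^l|a_j| \;:\; \sum_{j=1}^l a_j\sigma_j \text{ is a singular cycle with real coefficients representing } \alpha\Big\}$$ be its Gromov norm. Let $N$ be a closed topological manifold (compact, Hausdorff, locally homeomorphic to $\mathbb R^{n}$), let $k=n+1$, and let $i:N\times S^1\to M$ be a topological embedding. Call $c\in H_k(N\times S^1;\mathbb Z)$ a fundamental class if for every point $x$ its image generates $H_k(N\times S^1,(N\times S^1)\setminus\{x\};\mathbb Z)\cong\mathbb Z$; it exists exactly when $N$ is orientable, and it corresponds to a choice of orientation of $N\times S^1$. If $\alpha\in H_k(M;\mathbb R)$ is represented by the submanifold $N\times S^1$, that is, if $\alpha=i_*(c_{\mathbb R})$, where $c_{\mathbb R}\in H_k(N\times S^1;\mathbb R)$ is the image of a fundamental class $c$ under $H_k(N\times S^1;\mathbb Z)\to H_k(N\times S^1;\mathbb R)$, then $\|\alpha\|_1=0$. -/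

import Mathlib

open CategoryTheory Limits AlgebraicTopology Topology

universe u

noncomputable section

namespace GromovNorm

/-- The coefficient group `ℤ`. -/
abbrev Zcoeff : AddCommGrpCat.{u} := AddCommGrpCat.of (ULift.{u} ℤ)

/-- The coefficient group `ℝ`. -/
abbrev Rcoeff : AddCommGrpCat.{u} := AddCommGrpCat.of (ULift.{u} ℝ)

/-- The inclusion `ℤ → ℝ` of coefficient groups. -/
def intToReal : Zcoeff.{u} ⟶ Rcoeff.{u} :=
  AddCommGrpCat.ofHom
    { toFun := fun a => ULift.up (a.down : ℝ)
      map_zero' := by ext; simp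
      map_add' := fun a b => by ext; simp }

/-- The singular chain complex `C_•(X; A)`. -/
abbrev chains (A : AddCommGrpCat.{u}) (X : Type u) [TopologicalSpace X] :
    ChainComplex AddCommGrpCat.{u} ℕ :=
  ((singularChainComplexFunctor AddCommGrpCat.{u}).obj A).obj (TopCat.of X)

/-- The singular homology group `H_k(X; A)`. -/
abbrev homology (A : AddCommGrpCat.{u}) (k : ℕ) (X : Type u) [TopologicalSpace X] :
    AddCommGrpCat.{u} :=
  ((singularHomologyFunctor AddCommGrpCat.{u} k).obj A).obj (TopCat.of X)

section
variable {X Y : Type u} [TopologicalSpace X] [TopologicalSpace Y]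

/-- The chain map `f_# : C_•(X; A) → C_•(Y; A)`. -/
abbrev chainsMap (A : AddCommGrpCat.{u}) (f : C(X, Y)) : chains A X ⟶ chains A Y :=
  ((singularChainComplexFunctor AddCommGrpCat.{u}).obj A).map (TopCat.ofHom f)

/-- The induced map `f_* : H_k(X; A) → H_k(Y; A)`. -/
abbrev pushforward (A : AddCommGrpCat.{u}) (k : ℕ) (f : C(X, Y)) :
    homology A k X ⟶ homology A k Y :=
  ((singularHomologyFunctor AddCommGrpCat.{u} k).obj A).map (TopCat.ofHom f)

/-- The change of coefficients `H_k(X; ℤ) → H_k(X; ℝ)`. -/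
abbrev realify (k : ℕ) (X : Type u) [TopologicalSpace X] :
    homology Zcoeff k X ⟶ homology Rcoeff k X :=
  ((singularHomologyFunctor AddCommGrpCat.{u} k).map intToReal).app (TopCat.of X)

/-- The relative singular chain complex `C_•(X, S; A) = C_•(X; A) / C_•(S; A)`. -/
abbrev relChains (A : AddCommGrpCat.{u}) (S : Set X) : ChainComplex AddCommGrpCat.{u} ℕ :=
  cokernel (chainsMap A (ContinuousMap.mk (Subtype.val : S → X) continuous_subtype_val))

/-- The relative singular homology group `H_k(X, S; A)`. -/
abbrev relHomology (A : AddCommGrpCat.{u}) (k : ℕ) (S : Set X) : AddCommGrpCat.{u} :=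
  (relChains A S).homology k

/-- The natural map `H_k(X; A) → H_k(X, S; A)`. -/
abbrev toRelHomology (A : AddCommGrpCat.{u}) (k : ℕ) (S : Set X) :
    homology A k X ⟶ relHomology A k S :=
  HomologicalComplex.homologyMap (cokernel.π _ : chains A X ⟶ relChains A S) k

/-- A class `c ∈ H_k(X; ℤ)` of a closed `k`-manifold `X` is a fundamental class (for some
orientation of `X`) if, for every `x`, its image generates the local homology group
`H_k(X, X ∖ {x}; ℤ) ≅ ℤ`. -/
def IsFundamentalClass {k : ℕ} (c : homology Zcoeff.{u} k X) : Prop :=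
  ∀ x : X, AddSubgroup.zmultiples (toRelHomology Zcoeff k ({x}ᶜ : Set X) c) = ⊤

/-- `α ∈ H_k(Y; ℝ)` is represented by the closed oriented `k`-manifold `X` sitting in `Y` through
`i : X → Y`: it is the image under `i_*` of the real fundamental class of `X`, for some orientation
of `X`. -/
def IsRepresentedBy {k : ℕ} (α : homology Rcoeff.{u} k Y) (i : C(X, Y)) : Prop :=
  ∃ c : homology Zcoeff.{u} k X,
    IsFundamentalClass c ∧ pushforward Rcoeff k i (realify k X c) = α

/-- For a singular `k`-simplex `σ` of `X`, the homomorphism `ℝ → C_k(X; ℝ)`, `r ↦ r σ`. -/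
def simplexHom {k : ℕ} (σ : C(stdSimplex ℝ (Fin (k + 1)), X)) :
    Rcoeff.{u} ⟶ (chains Rcoeff.{u} X).X k :=
  (TopCat.toSSet.obj (TopCat.of X)).ιChainComplex (R := Rcoeff.{u}) (n := k)
    ((TopCat.toSSetObjEquiv (TopCat.of X) (.op (SimplexCategory.mk k))).symm σ)

/-- The singular chain `∑ a_σ σ` with real coefficients, for a finitely supported family `a`
indexed by the singular `k`-simplices `σ` of `X`. -/
def chainOf {k : ℕ} (a : C(stdSimplex ℝ (Fin (k + 1)), X) →₀ ℝ) : (chains Rcoeff.{u} X).X k :=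
  ∑ σ ∈ a.support, simplexHom σ (ULift.up (a σ))

/-- `∑ a_σ σ` is a cycle and represents the homology class `α`. -/
def IsCycleRepresenting {k : ℕ} (a : C(stdSimplex ℝ (Fin (k + 1)), X) →₀ ℝ)
    (α : homology Rcoeff.{u} k X) : Prop :=
  ∃ z : (chains Rcoeff.{u} X).cycles k,
    (chains Rcoeff.{u} X).iCycles k z = chainOf a ∧ (chains Rcoeff.{u} X).homologyπ k z = α

/-- The Gromov norm
`‖α‖₁ = inf {∑ |a_σ| : ∑ a_σ σ is a cycle representing α}` of `α ∈ H_k(X; ℝ)`. -/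
def gromovNorm {k : ℕ} (α : homology Rcoeff.{u} k X) : ℝ :=
  sInf {r : ℝ | ∃ a : C(stdSimplex ℝ (Fin (k + 1)), X) →₀ ℝ,
    IsCycleRepresenting a α ∧ r = ∑ σ ∈ a.support, |a σ|}

/-- Every chain is of the form `∑ a_σ σ`. -/
theorem exists_chainOf_eq {k : ℕ} (x : (chains Rcoeff.{u} X).X k) :
    ∃ a : C(stdSimplex ℝ (Fin (k + 1)), X) →₀ ℝ, chainOf a = x := by
  let Φ : (C(stdSimplex ℝ (Fin (k + 1)), X) →₀ ℝ) →+ (chains Rcoeff.{u} X).X k :=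
    Finsupp.liftAddHom fun σ => (simplexHom σ).hom.comp AddEquiv.ulift.symm.toAddMonoidHom
  have hΦ : ∀ a, Φ a = chainOf a := fun a => rfl
  let q : (chains Rcoeff.{u} X).X k ⟶ AddCommGrpCat.of ((chains Rcoeff.{u} X).X k ⧸ Φ.range) :=
    AddCommGrpCat.ofHom (QuotientAddGroup.mk' Φ.range)
  have hq : q = 0 := by
    refine SSet.chainComplex_hom_ext (X := TopCat.toSSet.obj (TopCat.of X)) fun τ => ?_
    obtain ⟨σ, rfl⟩ :=
      (TopCat.toSSetObjEquiv (TopCat.of X) (.op (SimplexCategory.mk k))).symm.surjective τ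
    ext r
    refine (QuotientAddGroup.eq_zero_iff _).2 ⟨Finsupp.single σ r.down, ?_⟩
    exact Finsupp.liftAddHom_apply_single _ _ _
  obtain ⟨a, ha⟩ := (QuotientAddGroup.eq_zero_iff x).1 (congrArg (fun f => f.hom x) hq)
  exact ⟨a, (hΦ a).symm.trans ha⟩

/-- Every homology class is represented by a cycle `∑ a_σ σ`; so the infimum that defines the
Gromov norm is over a nonempty set of nonnegative numbers. -/
theorem exists_isCycleRepresenting {k : ℕ} (α : homology Rcoeff.{u} k X) :
    ∃ a : C(stdSimplex ℝ (Fin (k + 1)), X) →₀ ℝ, IsCycleRepresenting a α := by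
  obtain ⟨z, hz⟩ := (AddCommGrpCat.epi_iff_surjective
    ((chains Rcoeff.{u} X).homologyπ k)).1 inferInstance α
  obtain ⟨a, ha⟩ := exists_chainOf_eq ((chains Rcoeff.{u} X).iCycles k z)
  exact ⟨a, z, ha.symm, hz⟩

end

end GromovNorm

end

/-!
The maps `q_d (x, z) = (x, z ^ d)` of `N × S¹` have degree `d`. More precisely, they multiply every
class of `H_{n+1}(N × S¹; ℝ)` by `d`, when `N` is a compact `n`-manifold. So a cycle `a` is
homologous to `d⁻¹ q_d(a)`, whose `ℓ¹`-norm is at most `‖a‖₁ / d`, and letting `d → ∞` shows that the norm of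
every class of degree `n + 1`, hence of its image in any space, vanishes
(`gromovNorm_pushforward_prod_circle`). In particular this holds for fundamental classes.

That `q_d` multiplies by `d` is `exists_bdry_eq_push_circlePow_sub`. Let `τ` generate the deck
transformations of `p : N × ℝ → N × S¹`. Singular simplices lift to `N × ℝ`, uniquely up to powers
of `τ`, so `0 → C_•(N × ℝ) → C_•(N × ℝ) → C_•(N × S¹) → 0`, with the maps `1 - τ` and `p`, is exact
(in nonnegative degrees). If `c` is a lift of the cycle `a`, then `∂c = (1 - τ) e` for a cycle `e`.
For the lift `s (x, t) = (x, d t)` of `q_d` this gives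
`∂ s c = (1 - τ ^ d) s e = (1 - τ) ∑_{j < d} τ ^ j s e`, and all `τ ^ j s` are homotopic to the
identity. Hence `s c - d c` is a cycle up to the image of `1 - τ`, and as
`H_{n+1}(N × ℝ) = H_{n+1}(N) = 0`, `q_d(a) - d a` bounds.

The vanishing of `H_l(N)` for `l > n` is `exists_bdry_eq_of_compact_manifold`. Its proof considers
the property `RelVanish l A`, that is `H_l(X, X ∖ A) = 0`, for closed sets `A`. By Mayer-Vietoris
sequences it passes to unions and intersections. For boxes in `ℝⁿ` it follows by induction on the
number of bounded coordinates, since a box is the intersection of two half-infinite ones, which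
have no relative homology because they can be translated away. Then it follows for finite unions of
boxes, for compact sets in `ℝⁿ` (a relative cycle misses a neighborhood that is a union of boxes),
by excision for compact sets in a chart, and finally for `N` itself.

The argument uses a hands-on model of singular chains, `Sing X l`, finitely supported functions on
the singular simplices with `l` vertices. Simplices without vertices are included, so that this is
the augmented complex, which makes the recursive cone constructions uniform. Natural operators
(subdivision, its homotopy to the identity, the prism operator) are first built by coning on ordered
chains of points of a convex set (`coneOp`, `tupSd`) and then transported by `realize`. The chain
groups are identified with those of Mathlib by `chainHom`.
-/


noncomputable section

namespace GromovNorm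

/-! ### Ordered chains on a set of vertices -/

/-- The degree `l - 1` part of the augmented complex of ordered chains on a set `K` of vertices:
formal real combinations of `l`-tuples of points of `K`. -/
abbrev Tup (K : Type*) (l : ℕ) := (Fin l → K) →₀ ℝ

/-- To check that a linear map sends chains carried by `s` into a submodule, it suffices to look at
the basis. -/
theorem linearMap_mem_of_mem_supported {α M : Type*} [AddCommGroup M] [Module ℝ M]
    {s : Set α} {p : Submodule ℝ M} (f : (α →₀ ℝ) →ₗ[ℝ] M)
    (h : ∀ a ∈ s, f (Finsupp.single a 1) ∈ p) {c : α →₀ ℝ} (hc : c ∈ Finsupp.supported ℝ ℝ s) :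
    f c ∈ p := by
  rw [Finsupp.supported_eq_span_single] at hc
  have : Submodule.span ℝ ((fun i => Finsupp.single i (1 : ℝ)) '' s) ≤ p.comap f := by
    rw [Submodule.span_le]
    rintro _ ⟨a, ha, rfl⟩
    exact h a ha
  exact this hc

section Tuples
variable {K K' K₁ K₁' : Type*}

/-- The simplicial boundary of ordered chains. -/
def tupBdry (l : ℕ) : Tup K (l + 1) →ₗ[ℝ] Tup K l :=
  Finsupp.linearCombination ℝ fun v =>
    ∑ i : Fin (l + 1), (-1 : ℝ) ^ (i : ℕ) • Finsupp.single (v ∘ i.succAbove) 1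

/-- The cone `b * c`: the vertex `b` is put in front of every tuple. -/
def cone (b : K) (l : ℕ) : Tup K l →ₗ[ℝ] Tup K (l + 1) :=
  Finsupp.lmapDomain ℝ ℝ fun v => (Fin.cons b v : Fin (l + 1) → K)

/-- The map of ordered chains induced by a map of vertices. -/
def tupMap (f : K → K') (l : ℕ) : Tup K l →ₗ[ℝ] Tup K' l :=
  Finsupp.lmapDomain ℝ ℝ fun v => f ∘ v

theorem tupBdry_single {l : ℕ} (v : Fin (l + 1) → K) :
    tupBdry l (Finsupp.single v 1) =
      ∑ i : Fin (l + 1), (-1 : ℝ) ^ (i : ℕ) • Finsupp.single (v ∘ i.succAbove) 1 := by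
  simp [tupBdry]

@[simp]
theorem cone_single {l : ℕ} (b : K) (v : Fin l → K) (r : ℝ) :
    cone b l (Finsupp.single v r) = Finsupp.single (Fin.cons b v) r := by
  simp [cone]

@[simp]
theorem tupMap_single {l : ℕ} (f : K → K') (v : Fin l → K) (r : ℝ) :
    tupMap f l (Finsupp.single v r) = Finsupp.single (f ∘ v) r := by
  simp [tupMap]

theorem tupBdry_tupMap {l : ℕ} (f : K → K') (c : Tup K (l + 1)) :
    tupBdry l (tupMap f (l + 1) c) = tupMap f l (tupBdry l c) := by
  suffices h : tupBdry l ∘ₗ tupMap f (l + 1) = tupMap f l ∘ₗ tupBdry l from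
    LinearMap.congr_fun h c
  refine Finsupp.lhom_ext' fun v => LinearMap.ext_ring ?_
  simp [tupBdry_single, Function.comp_assoc]

theorem tupMap_cone {l : ℕ} (f : K → K') (b : K) (c : Tup K l) :
    tupMap f (l + 1) (cone b l c) = cone (f b) l (tupMap f l c) := by
  suffices h : tupMap f (l + 1) ∘ₗ cone b l = cone (f b) l ∘ₗ tupMap f l from
    LinearMap.congr_fun h c
  refine Finsupp.lhom_ext' fun v => LinearMap.ext_ring ?_
  simp only [LinearMap.comp_apply, Finsupp.lsingle_apply, cone_single, tupMap_single]
  congr 1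
  exact Fin.comp_cons f b v

theorem tupBdry_cone_zero (b : K) (c : Tup K 0) : tupBdry 0 (cone b 0 c) = c := by
  suffices h : tupBdry 0 ∘ₗ cone b 0 = LinearMap.id from LinearMap.congr_fun h c
  refine Finsupp.lhom_ext' fun v => LinearMap.ext_ring ?_
  simp only [LinearMap.comp_apply, Finsupp.lsingle_apply, cone_single, tupBdry_single,
    LinearMap.id_apply]
  rw [Fin.sum_univ_one, Fin.val_zero, pow_zero, one_smul]
  congr 1

theorem tupBdry_cone {l : ℕ} (b : K) (c : Tup K (l + 1)) :
    tupBdry (l + 1) (cone b (l + 1) c) = c - cone b l (tupBdry l c) := by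
  suffices h : tupBdry (l + 1) ∘ₗ cone b (l + 1) = LinearMap.id - cone b l ∘ₗ tupBdry l from
    LinearMap.congr_fun h c
  refine Finsupp.lhom_ext' fun v => LinearMap.ext_ring ?_
  simp only [LinearMap.comp_apply, Finsupp.lsingle_apply, cone_single, tupBdry_single,
    LinearMap.id_apply, LinearMap.sub_apply, map_sum, map_smul]
  rw [Fin.sum_univ_succ, sub_eq_add_neg, ← Finset.sum_neg_distrib]
  congr 1
  · simp only [Fin.val_zero, pow_zero, one_smul]
    congr 1
  · refine Finset.sum_congr rfl fun i _ => ?_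
    rw [Fin.val_succ, pow_succ, mul_neg_one, neg_smul]
    congr 3
    funext j
    refine Fin.cases ?_ (fun j => ?_) j
    · simp
    · simp

theorem tupBdry_tupBdry {l : ℕ} (c : Tup K (l + 2)) : tupBdry l (tupBdry (l + 1) c) = 0 := by
  induction l with
  | zero =>
    suffices h : tupBdry 0 ∘ₗ tupBdry 1 = (0 : Tup K 2 →ₗ[ℝ] Tup K 0) from LinearMap.congr_fun h c
    refine Finsupp.lhom_ext' fun v => LinearMap.ext_ring ?_
    have hv : Finsupp.single v (1 : ℝ) = cone (v 0) 1 (Finsupp.single (Fin.tail v) 1) := by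
      rw [cone_single, Fin.cons_self_tail]
    simp only [LinearMap.comp_apply, Finsupp.lsingle_apply, LinearMap.zero_apply]
    rw [hv, tupBdry_cone, map_sub, tupBdry_cone_zero, sub_self]
  | succ l ih =>
    suffices h : tupBdry (l + 1) ∘ₗ tupBdry (l + 2) = (0 : Tup K (l + 3) →ₗ[ℝ] Tup K (l + 1)) from
      LinearMap.congr_fun h c
    refine Finsupp.lhom_ext' fun v => LinearMap.ext_ring ?_
    have hv : Finsupp.single v (1 : ℝ) = cone (v 0) (l + 2) (Finsupp.single (Fin.tail v) 1) := by
      rw [cone_single, Fin.cons_self_tail]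
    simp only [LinearMap.comp_apply, Finsupp.lsingle_apply, LinearMap.zero_apply]
    rw [hv, tupBdry_cone, map_sub, tupBdry_cone, ih, map_zero, sub_zero, sub_self]

/-- The operator `D [v] = b(v) * (φ [v] - D ∂[v])` of degree one. When `φ` is a chain map that
vanishes on the empty tuple, it is a chain homotopy from `0` to `φ`
(`tupBdry_coneOp_add_coneOp_tupBdry`). -/
def coneOp (φ : ∀ l, Tup K l →ₗ[ℝ] Tup K' l) (b : ∀ l, (Fin (l + 1) → K) → K') :
    ∀ l, Tup K l →ₗ[ℝ] Tup K' (l + 1)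
  | 0 => 0
  | l + 1 => Finsupp.linearCombination ℝ fun v => cone (b l v) (l + 1)
      (φ (l + 1) (Finsupp.single v 1) - coneOp φ b l (tupBdry l (Finsupp.single v 1)))

theorem coneOp_single (φ : ∀ l, Tup K l →ₗ[ℝ] Tup K' l) (b : ∀ l, (Fin (l + 1) → K) → K')
    (l : ℕ) (v : Fin (l + 1) → K) :
    coneOp φ b (l + 1) (Finsupp.single v 1) = cone (b l v) (l + 1)
      (φ (l + 1) (Finsupp.single v 1) - coneOp φ b l (tupBdry l (Finsupp.single v 1))) := by
  simp [coneOp]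

theorem tupBdry_coneOp_add_coneOp_tupBdry (φ : ∀ l, Tup K l →ₗ[ℝ] Tup K' l)
    (b : ∀ l, (Fin (l + 1) → K) → K') (h0 : φ 0 = 0)
    (hφ : ∀ l c, tupBdry l (φ (l + 1) c) = φ l (tupBdry l c)) (l : ℕ) (c : Tup K (l + 1)) :
    tupBdry (l + 1) (coneOp φ b (l + 1) c) + coneOp φ b l (tupBdry l c) = φ (l + 1) c := by
  suffices h : tupBdry (l + 1) ∘ₗ coneOp φ b (l + 1) + coneOp φ b l ∘ₗ tupBdry l = φ (l + 1) from
    LinearMap.congr_fun h c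
  induction l with
  | zero =>
    refine Finsupp.lhom_ext' fun v => LinearMap.ext_ring ?_
    simp only [LinearMap.comp_apply, Finsupp.lsingle_apply, LinearMap.add_apply, coneOp_single]
    rw [tupBdry_cone]
    simp [coneOp, hφ, h0]
  | succ l ih =>
    refine Finsupp.lhom_ext' fun v => LinearMap.ext_ring ?_
    simp only [LinearMap.comp_apply, Finsupp.lsingle_apply, LinearMap.add_apply, coneOp_single]
    have ih' := LinearMap.congr_fun (ih 0) (tupBdry (l + 1) (Finsupp.single v 1))
    simp only [LinearMap.comp_apply, LinearMap.add_apply, tupBdry_tupBdry, map_zero,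
      add_zero] at ih'
    rw [tupBdry_cone, map_sub, hφ, ih']
    simp

theorem coneOp_tupMap (φ : ∀ l, Tup K l →ₗ[ℝ] Tup K' l) (b : ∀ l, (Fin (l + 1) → K) → K')
    (φ₁ : ∀ l, Tup K₁ l →ₗ[ℝ] Tup K₁' l) (b₁ : ∀ l, (Fin (l + 1) → K₁) → K₁')
    (f : K → K₁) (f' : K' → K₁') (hb : ∀ l v, b₁ l (f ∘ v) = f' (b l v))
    (hφ : ∀ l c, φ₁ l (tupMap f l c) = tupMap f' l (φ l c)) (l : ℕ) (c : Tup K l) :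
    coneOp φ₁ b₁ l (tupMap f l c) = tupMap f' (l + 1) (coneOp φ b l c) := by
  suffices h : coneOp φ₁ b₁ l ∘ₗ tupMap f l = tupMap f' (l + 1) ∘ₗ coneOp φ b l from
    LinearMap.congr_fun h c
  induction l with
  | zero => simp [coneOp]
  | succ l ih =>
    refine Finsupp.lhom_ext' fun v => LinearMap.ext_ring ?_
    have ih' := LinearMap.congr_fun (ih 0) (tupBdry l (Finsupp.single v 1))
    simp only [LinearMap.comp_apply] at ih'
    simp only [LinearMap.comp_apply, Finsupp.lsingle_apply, tupMap_single, coneOp_single]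
    rw [tupMap_cone, ← hb, (tupMap f' (l + 1)).map_sub, ← hφ, ← ih', ← tupBdry_tupMap,
      tupMap_single]

/-- Subdivision of ordered chains with respect to a choice `b` of "barycenters":
`sd [v] = b(v) * sd ∂[v]`. -/
def tupSd (b : ∀ l, (Fin (l + 1) → K) → K) : ∀ l, Tup K l →ₗ[ℝ] Tup K l
  | 0 => LinearMap.id
  | l + 1 => Finsupp.linearCombination ℝ fun v =>
      cone (b l v) l (tupSd b l (tupBdry l (Finsupp.single v 1)))

theorem tupSd_single (b : ∀ l, (Fin (l + 1) → K) → K) (l : ℕ) (v : Fin (l + 1) → K) :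
    tupSd b (l + 1) (Finsupp.single v 1) =
      cone (b l v) l (tupSd b l (tupBdry l (Finsupp.single v 1))) := by
  simp [tupSd]

theorem tupBdry_tupSd (b : ∀ l, (Fin (l + 1) → K) → K) (l : ℕ) (c : Tup K (l + 1)) :
    tupBdry l (tupSd b (l + 1) c) = tupSd b l (tupBdry l c) := by
  suffices h : tupBdry l ∘ₗ tupSd b (l + 1) = tupSd b l ∘ₗ tupBdry l from
    LinearMap.congr_fun h c
  induction l with
  | zero =>
    refine Finsupp.lhom_ext' fun v => LinearMap.ext_ring ?_
    simp only [LinearMap.comp_apply, Finsupp.lsingle_apply, tupSd_single]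
    rw [tupBdry_cone_zero]
  | succ l ih =>
    refine Finsupp.lhom_ext' fun v => LinearMap.ext_ring ?_
    have ih' := LinearMap.congr_fun (ih 0) (tupBdry (l + 1) (Finsupp.single v 1))
    simp only [LinearMap.comp_apply, tupBdry_tupBdry, map_zero] at ih'
    simp only [LinearMap.comp_apply, Finsupp.lsingle_apply, tupSd_single]
    rw [tupBdry_cone, ih', map_zero, sub_zero]

theorem tupSd_tupMap (b : ∀ l, (Fin (l + 1) → K) → K) (b' : ∀ l, (Fin (l + 1) → K') → K')
    (f : K → K') (hb : ∀ l v, b' l (f ∘ v) = f (b l v)) (l : ℕ) (c : Tup K l) :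
    tupSd b' l (tupMap f l c) = tupMap f l (tupSd b l c) := by
  suffices h : tupSd b' l ∘ₗ tupMap f l = tupMap f l ∘ₗ tupSd b l from
    LinearMap.congr_fun h c
  induction l with
  | zero => simp [tupSd]
  | succ l ih =>
    refine Finsupp.lhom_ext' fun v => LinearMap.ext_ring ?_
    have ih' := LinearMap.congr_fun (ih 0) (tupBdry l (Finsupp.single v 1))
    simp only [LinearMap.comp_apply] at ih'
    simp only [LinearMap.comp_apply, Finsupp.lsingle_apply, tupMap_single, tupSd_single]
    rw [tupMap_cone, ← hb, ← ih', ← tupBdry_tupMap, tupMap_single]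

end Tuples

/-! ### Singular chains and affine simplices -/

/-- The standard simplex with `l` vertices, of dimension `l - 1`. -/
abbrev Simp (l : ℕ) := stdSimplex ℝ (Fin l)

/-- The face inclusion `δ^i`. -/
def faceMap (l : ℕ) (i : Fin (l + 1)) : C(Simp l, Simp (l + 1)) :=
  ⟨stdSimplex.map i.succAbove, stdSimplex.continuous_map _⟩

/-- Singular chains of `X` with real coefficients in degree `l - 1`. Since the simplex without
vertices is empty, degree `-1` is a copy of `ℝ`, and this is the augmented singular complex. -/
abbrev Sing (X : Type*) [TopologicalSpace X] (l : ℕ) := C(Simp l, X) →₀ ℝ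

section Affine
variable {E : Type*} [NormedAddCommGroup E] [NormedSpace ℝ E] {K : Set E} (hK : Convex ℝ K)

/-- The affine simplex in a convex set `K` with given vertices. -/
def affSimplex {l : ℕ} (v : Fin l → K) : C(Simp l, K) where
  toFun t := ⟨∑ i, t i • (v i : E),
    hK.sum_mem (fun i _ => t.2.1 i) t.2.2 fun i _ => (v i).2⟩
  continuous_toFun := by
    refine Continuous.subtype_mk (continuous_finsetSum _ fun i _ => ?_) _
    exact ((continuous_apply i).comp continuous_subtype_val).smul continuous_const

theorem coe_affSimplex {l : ℕ} (v : Fin l → K) (t : Simp l) :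
    (affSimplex hK v t : E) = ∑ i, t i • (v i : E) := rfl

theorem affSimplex_comp_faceMap {l : ℕ} (v : Fin (l + 1) → K) (i : Fin (l + 1)) :
    (affSimplex hK v).comp (faceMap l i) = affSimplex hK (v ∘ i.succAbove) := by
  ext t
  simp only [ContinuousMap.comp_apply, coe_affSimplex, Function.comp_apply]
  rw [Fin.sum_univ_succAbove _ i]
  have h1 : faceMap l i t i = 0 := by
    simp only [faceMap, ContinuousMap.coe_mk, stdSimplex.map_coe,
      FunOnFinite.linearMap_apply_apply]
    exact Finset.sum_eq_zero fun j hj => absurd (Finset.mem_filter.1 hj).2 (Fin.succAbove_ne i j)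
  have h2 : ∀ j, faceMap l i t (i.succAbove j) = t j := by
    intro j
    simp only [faceMap, ContinuousMap.coe_mk, stdSimplex.map_coe,
      FunOnFinite.linearMap_apply_apply]
    rw [Finset.sum_eq_single_of_mem j (by simp)]
    intro b hb hbj
    exact absurd (Fin.succAbove_right_injective (Finset.mem_filter.1 hb).2) hbj
  simp [h1, h2]

/-- The vertices of the standard simplex. -/
def simpVertex (l : ℕ) (i : Fin l) : Simp l := stdSimplex.vertex i

/-- The affine simplex of the standard simplex itself with its own vertices. -/
theorem affSimplex_simpVertex (l : ℕ) :
    affSimplex (convex_stdSimplex ℝ (Fin l)) (simpVertex l) = ContinuousMap.id _ := by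
  ext t j
  change (∑ i, t i • (Pi.single i (1 : ℝ) : Fin l → ℝ)) j = t j
  simp [Finset.sum_apply, Pi.single_apply]

theorem affSimplex_affSimplex {l m : ℕ} (w : Fin m → K) (v : Fin l → Simp m) (t : Simp l) :
    affSimplex hK w (affSimplex (convex_stdSimplex ℝ (Fin m)) v t) =
      affSimplex hK (affSimplex hK w ∘ v) t := by
  ext
  simp only [coe_affSimplex, Function.comp_apply]
  have : ∀ i, (affSimplex (convex_stdSimplex ℝ (Fin m)) v t) i = ∑ j, t j * v j i := by
    intro i
    change (∑ j, t j • (v j : Fin m → ℝ)) i = _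
    simp only [Finset.sum_apply, Pi.smul_apply, smul_eq_mul]
  simp only [this, Finset.sum_smul, Finset.smul_sum, smul_smul]
  exact Finset.sum_comm

theorem affSimplex_comp_simpVertex {l : ℕ} (v : Fin l → K) :
    affSimplex hK v ∘ simpVertex l = v := by
  funext i
  ext
  rw [Function.comp_apply, coe_affSimplex]
  change ∑ j, (Pi.single i (1 : ℝ) : Fin l → ℝ) j • (v j : E) = v i
  simp [Pi.single_apply]

/-- The barycenter of a nonempty tuple of points of a convex set. -/
def bary (l : ℕ) (v : Fin (l + 1) → K) : K := affSimplex hK v stdSimplex.barycenter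

theorem bary_affSimplex {l m : ℕ} (w : Fin m → K) (v : Fin (l + 1) → Simp m) :
    bary hK l (affSimplex hK w ∘ v) =
      affSimplex hK w (bary (convex_stdSimplex ℝ (Fin m)) l v) :=
  (affSimplex_affSimplex hK w v _).symm

variable {X Y : Type*} [TopologicalSpace X] [TopologicalSpace Y]

/-- The singular boundary. -/
def bdry (l : ℕ) : Sing X (l + 1) →ₗ[ℝ] Sing X l :=
  Finsupp.linearCombination ℝ fun σ =>
    ∑ i : Fin (l + 1), (-1 : ℝ) ^ (i : ℕ) • Finsupp.single (σ.comp (faceMap l i)) 1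

theorem bdry_single {l : ℕ} (σ : C(Simp (l + 1), X)) :
    bdry l (Finsupp.single σ 1) =
      ∑ i : Fin (l + 1), (-1 : ℝ) ^ (i : ℕ) • Finsupp.single (σ.comp (faceMap l i)) 1 := by
  simp [bdry]

/-- The map of singular chains induced by a continuous map. -/
def push (f : C(X, Y)) (l : ℕ) : Sing X l →ₗ[ℝ] Sing Y l :=
  Finsupp.lmapDomain ℝ ℝ fun σ => f.comp σ

@[simp]
theorem push_single (f : C(X, Y)) {l : ℕ} (σ : C(Simp l, X)) (r : ℝ) :
    push f l (Finsupp.single σ r) = Finsupp.single (f.comp σ) r := by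
  simp [push]

theorem bdry_push (f : C(X, Y)) {l : ℕ} (c : Sing X (l + 1)) :
    bdry l (push f (l + 1) c) = push f l (bdry l c) := by
  suffices h : bdry l ∘ₗ push f (l + 1) = push f l ∘ₗ bdry l from LinearMap.congr_fun h c
  refine Finsupp.lhom_ext' fun v => LinearMap.ext_ring ?_
  simp [bdry_single, ContinuousMap.comp_assoc]

theorem push_push {Z : Type*} [TopologicalSpace Z] (g : C(Y, Z)) (f : C(X, Y)) {l : ℕ}
    (c : Sing X l) : push g l (push f l c) = push (g.comp f) l c := by
  suffices h : push g l ∘ₗ push f l = push (g.comp f) l from LinearMap.congr_fun h c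
  refine Finsupp.lhom_ext' fun v => LinearMap.ext_ring ?_
  simp [ContinuousMap.comp_assoc]

theorem push_id {l : ℕ} (c : Sing X l) : push (ContinuousMap.id X) l c = c := by
  suffices h : push (ContinuousMap.id X) l = LinearMap.id from LinearMap.congr_fun h c
  refine Finsupp.lhom_ext' fun v => LinearMap.ext_ring ?_
  simp

/-- The singular chain given by an ordered chain on a convex set `K` and a continuous map
`F : K → X`: each tuple is replaced by its affine simplex, followed by `F`. -/
def realize (F : C(K, X)) (l : ℕ) : Tup K l →ₗ[ℝ] Sing X l :=
  Finsupp.lmapDomain ℝ ℝ fun v => F.comp (affSimplex hK v)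

@[simp]
theorem realize_single (F : C(K, X)) {l : ℕ} (v : Fin l → K) (r : ℝ) :
    realize hK F l (Finsupp.single v r) = Finsupp.single (F.comp (affSimplex hK v)) r := by
  simp [realize]

theorem bdry_realize (F : C(K, X)) {l : ℕ} (c : Tup K (l + 1)) :
    bdry l (realize hK F (l + 1) c) = realize hK F l (tupBdry l c) := by
  suffices h : bdry l ∘ₗ realize hK F (l + 1) = realize hK F l ∘ₗ tupBdry l from
    LinearMap.congr_fun h c
  refine Finsupp.lhom_ext' fun v => LinearMap.ext_ring ?_
  simp [bdry_single, tupBdry_single, ContinuousMap.comp_assoc, affSimplex_comp_faceMap]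

theorem realize_tupMap_affSimplex (F : C(K, X)) {l m : ℕ} (w : Fin m → K) (c : Tup (Simp m) l) :
    realize hK F l (tupMap (affSimplex hK w) l c) =
      realize (convex_stdSimplex ℝ (Fin m)) (F.comp (affSimplex hK w)) l c := by
  suffices h : realize hK F l ∘ₗ tupMap (affSimplex hK w) l =
      realize (convex_stdSimplex ℝ (Fin m)) (F.comp (affSimplex hK w)) l from
    LinearMap.congr_fun h c
  refine Finsupp.lhom_ext' fun v => LinearMap.ext_ring ?_
  simp only [LinearMap.comp_apply, Finsupp.lsingle_apply, tupMap_single, realize_single]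
  congr 1
  ext t
  exact congrArg F (affSimplex_affSimplex hK w v t).symm

theorem realize_simpVertex {l : ℕ} (σ : C(Simp l, X)) :
    realize (convex_stdSimplex ℝ (Fin l)) σ l (Finsupp.single (simpVertex l) 1) =
      Finsupp.single σ 1 := by
  rw [realize_single, affSimplex_simpVertex, ContinuousMap.comp_id]

theorem bdry_bdry {l : ℕ} (c : Sing X (l + 2)) : bdry l (bdry (l + 1) c) = 0 := by
  suffices h : bdry l ∘ₗ bdry (l + 1) = (0 : Sing X (l + 2) →ₗ[ℝ] Sing X l) from
    LinearMap.congr_fun h c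
  refine Finsupp.lhom_ext' fun σ => LinearMap.ext_ring ?_
  simp only [LinearMap.comp_apply, Finsupp.lsingle_apply]
  rw [← realize_simpVertex, bdry_realize, bdry_realize, tupBdry_tupBdry]
  simp

/-- The chains carried by a subset `S` of `X`. -/
abbrev carried (S : Set X) (l : ℕ) : Submodule ℝ (Sing X l) :=
  Finsupp.supported ℝ ℝ {σ | Set.range σ ⊆ S}

theorem carried_mono {S T : Set X} (h : S ⊆ T) (l : ℕ) : carried S l ≤ carried T l :=
  Finsupp.supported_mono fun _ hσ => Set.Subset.trans hσ h

theorem mem_carried_univ {l : ℕ} (c : Sing X l) : c ∈ carried (Set.univ : Set X) l := by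
  simp [carried]

theorem carried_inter (S T : Set X) (l : ℕ) :
    carried (S ∩ T) l = carried S l ⊓ carried T l := by
  rw [carried, carried, carried, ← Finsupp.supported_inter]
  congr 1
  ext σ
  exact Set.subset_inter_iff

theorem realize_mem_carried {S : Set X} {F : C(K, X)} (hF : Set.range F ⊆ S) {l : ℕ}
    (c : Tup K l) : realize hK F l c ∈ carried S l := by
  refine linearMap_mem_of_mem_supported (s := Set.univ) _ (fun v _ => ?_) (by simp)
  rw [realize_single]
  refine Finsupp.single_mem_supported ℝ _ ?_
  rintro _ ⟨t, rfl⟩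
  exact hF ⟨_, rfl⟩

theorem bdry_mem_carried {S : Set X} {l : ℕ} {c : Sing X (l + 1)} (hc : c ∈ carried S (l + 1)) :
    bdry l c ∈ carried S l := by
  refine linearMap_mem_of_mem_supported _ (fun σ hσ => ?_) hc
  rw [← realize_simpVertex, bdry_realize]
  exact realize_mem_carried _ hσ _

theorem push_mem_carried {f : C(X, Y)} {S : Set X} {T : Set Y} (h : Set.MapsTo f S T) {l : ℕ}
    {c : Sing X l} (hc : c ∈ carried S l) : push f l c ∈ carried T l := by
  refine linearMap_mem_of_mem_supported _ (fun σ hσ => ?_) hc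
  rw [push_single]
  refine Finsupp.single_mem_supported ℝ _ ?_
  rintro _ ⟨t, rfl⟩
  exact h (hσ ⟨t, rfl⟩)

end Affine

/-! ### Barycentric subdivision and small chains -/

section Subdivision
variable {E : Type*} [NormedAddCommGroup E] [NormedSpace ℝ E] {K : Set E} (hK : Convex ℝ K)
variable {X Y : Type*} [TopologicalSpace X] [TopologicalSpace Y]

/-- Barycentric subdivision of ordered chains in a convex set. -/
abbrev affSd (l : ℕ) : Tup K l →ₗ[ℝ] Tup K l := tupSd (bary hK) l

/-- The chain homotopy from barycentric subdivision to the identity, for ordered chains. -/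
abbrev affSdHtpy (l : ℕ) : Tup K l →ₗ[ℝ] Tup K (l + 1) :=
  coneOp (fun l => LinearMap.id - affSd hK l) (bary hK) l

/-- Barycentric subdivision of singular chains. -/
def singSd (l : ℕ) : Sing X l →ₗ[ℝ] Sing X l :=
  Finsupp.linearCombination ℝ fun σ =>
    realize (convex_stdSimplex ℝ (Fin l)) σ l
      (affSd (convex_stdSimplex ℝ (Fin l)) l (Finsupp.single (simpVertex l) 1))

/-- The chain homotopy from barycentric subdivision to the identity. -/
def singSdHtpy (l : ℕ) : Sing X l →ₗ[ℝ] Sing X (l + 1) :=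
  Finsupp.linearCombination ℝ fun σ =>
    realize (convex_stdSimplex ℝ (Fin l)) σ (l + 1)
      (affSdHtpy (convex_stdSimplex ℝ (Fin l)) l (Finsupp.single (simpVertex l) 1))

theorem affSd_tupMap_affSimplex {l m : ℕ} (w : Fin m → K) (c : Tup (Simp m) l) :
    affSd hK l (tupMap (affSimplex hK w) l c) =
      tupMap (affSimplex hK w) l (affSd (convex_stdSimplex ℝ (Fin m)) l c) :=
  tupSd_tupMap _ _ _ (fun _ v => bary_affSimplex hK w v) l c

/-- Subdivision is defined on the universal simplices only; naturality extends the formula to all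
realized chains. -/
theorem singSd_realize (F : C(K, X)) {l : ℕ} (c : Tup K l) :
    singSd l (realize hK F l c) = realize hK F l (affSd hK l c) := by
  suffices h : singSd l ∘ₗ realize hK F l = realize hK F l ∘ₗ affSd hK l from
    LinearMap.congr_fun h c
  refine Finsupp.lhom_ext' fun v => LinearMap.ext_ring ?_
  simp only [LinearMap.comp_apply, Finsupp.lsingle_apply, realize_single, singSd,
    Finsupp.linearCombination_single, one_smul]
  rw [← realize_tupMap_affSimplex, ← affSd_tupMap_affSimplex, tupMap_single,
    affSimplex_comp_simpVertex]

theorem singSdHtpy_realize (F : C(K, X)) {l : ℕ} (c : Tup K l) :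
    singSdHtpy l (realize hK F l c) = realize hK F (l + 1) (affSdHtpy hK l c) := by
  suffices h : singSdHtpy l ∘ₗ realize hK F l = realize hK F (l + 1) ∘ₗ affSdHtpy hK l from
    LinearMap.congr_fun h c
  refine Finsupp.lhom_ext' fun v => LinearMap.ext_ring ?_
  simp only [LinearMap.comp_apply, Finsupp.lsingle_apply, realize_single, singSdHtpy,
    Finsupp.linearCombination_single, one_smul]
  rw [← realize_tupMap_affSimplex, affSdHtpy, affSdHtpy,
    ← coneOp_tupMap _ _ (fun l => LinearMap.id - affSd hK l) (bary hK) _ _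
      (fun _ v => bary_affSimplex hK _ v), tupMap_single, affSimplex_comp_simpVertex]
  intro l c
  simp only [LinearMap.sub_apply, LinearMap.id_apply, map_sub, affSd_tupMap_affSimplex]

theorem singSd_single {l : ℕ} (σ : C(Simp l, X)) :
    singSd l (Finsupp.single σ 1) = realize (convex_stdSimplex ℝ (Fin l)) σ l
      (affSd (convex_stdSimplex ℝ (Fin l)) l (Finsupp.single (simpVertex l) 1)) := by
  simp [singSd]

theorem singSdHtpy_single {l : ℕ} (σ : C(Simp l, X)) :
    singSdHtpy l (Finsupp.single σ 1) = realize (convex_stdSimplex ℝ (Fin l)) σ (l + 1)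
      (affSdHtpy (convex_stdSimplex ℝ (Fin l)) l (Finsupp.single (simpVertex l) 1)) := by
  simp [singSdHtpy]

theorem bdry_singSd {l : ℕ} (c : Sing X (l + 1)) :
    bdry l (singSd (l + 1) c) = singSd l (bdry l c) := by
  suffices h : bdry l ∘ₗ singSd (l + 1) = singSd (X := X) l ∘ₗ bdry l from
    LinearMap.congr_fun h c
  refine Finsupp.lhom_ext' fun σ => LinearMap.ext_ring ?_
  simp only [LinearMap.comp_apply, Finsupp.lsingle_apply]
  rw [← realize_simpVertex, singSd_realize, bdry_realize, bdry_realize, singSd_realize,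
    tupBdry_tupSd]

theorem bdry_singSdHtpy_add {l : ℕ} (c : Sing X (l + 1)) :
    bdry (l + 1) (singSdHtpy (l + 1) c) + singSdHtpy l (bdry l c) = c - singSd (l + 1) c := by
  suffices h : bdry (l + 1) ∘ₗ singSdHtpy (l + 1) + singSdHtpy l ∘ₗ bdry l =
      LinearMap.id - singSd (X := X) (l + 1) from LinearMap.congr_fun h c
  refine Finsupp.lhom_ext' fun σ => LinearMap.ext_ring ?_
  simp only [LinearMap.comp_apply, Finsupp.lsingle_apply, LinearMap.add_apply,
    LinearMap.sub_apply, LinearMap.id_apply]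
  rw [← realize_simpVertex, singSd_realize, bdry_realize, singSdHtpy_realize, bdry_realize,
    singSdHtpy_realize, ← map_add, ← map_sub, tupBdry_coneOp_add_coneOp_tupBdry]
  · rfl
  · ext; simp [tupSd]
  · intro l c
    simp [tupBdry_tupSd]

theorem singSd_mem_carried {S : Set X} {l : ℕ} {c : Sing X l} (hc : c ∈ carried S l) :
    singSd l c ∈ carried S l := by
  refine linearMap_mem_of_mem_supported _ (fun σ hσ => ?_) hc
  rw [singSd_single]
  exact realize_mem_carried _ hσ _

theorem singSdHtpy_mem_carried {S : Set X} {l : ℕ} {c : Sing X l} (hc : c ∈ carried S l) :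
    singSdHtpy l c ∈ carried S (l + 1) := by
  refine linearMap_mem_of_mem_supported _ (fun σ hσ => ?_) hc
  rw [singSdHtpy_single]
  exact realize_mem_carried _ hσ _

/-- The barycenter of `l + 1` points of mutual distances at most `d` is within `l / (l + 1) * d` of
each of them, as one of the `l + 1` differences that are averaged vanishes. -/
theorem dist_bary_le {l : ℕ} (v : Fin (l + 1) → K) {d : ℝ} (hd : ∀ i j, dist (v i) (v j) ≤ d)
    (j : Fin (l + 1)) : dist (bary hK l v) (v j) ≤ l / (l + 1) * d := by
  have hl : (0 : ℝ) < l + 1 := by positivity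
  have h1 : (bary hK l v : E) - v j = ∑ i, (l + 1 : ℝ)⁻¹ • ((v i : E) - v j) := by
    simp only [smul_sub, Finset.sum_sub_distrib, Finset.sum_const, Finset.card_univ,
      Fintype.card_fin, bary, coe_affSimplex]
    congr 1
    · refine Finset.sum_congr rfl fun i _ => ?_
      congr 1
      change ((Fintype.card (Fin (l + 1)) : ℝ))⁻¹ = _
      simp
    · rw [← Nat.cast_smul_eq_nsmul ℝ, smul_smul]
      push_cast
      rw [mul_inv_cancel₀ hl.ne', one_smul]
  rw [Subtype.dist_eq, dist_eq_norm, h1, Fin.sum_univ_succAbove _ j]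
  simp only [sub_self, smul_zero, zero_add]
  refine (norm_sum_le_of_le (f := fun i => (l + 1 : ℝ)⁻¹ • ((v (j.succAbove i) : E) - v j))
    (n := fun _ => (l + 1 : ℝ)⁻¹ * d) _ fun i _ => ?_).trans (le_of_eq ?_)
  · rw [norm_smul, Real.norm_of_nonneg (by positivity), ← dist_eq_norm, ← Subtype.dist_eq]
    exact mul_le_mul_of_nonneg_left (hd _ _) (by positivity)
  · simp only [Finset.sum_const, Finset.card_univ, Fintype.card_fin, nsmul_eq_mul]
    field_simp

/-- The tuples that lie in `convexHull C` and whose points have mutual distances at most `d`. -/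
def smallTuples (C : Set E) (d : ℝ) (l : ℕ) : Set (Fin l → K) :=
  {v | (∀ i, (v i : E) ∈ convexHull ℝ C) ∧ ∀ i j, dist (v i) (v j) ≤ d}

/-- Barycentric subdivision shrinks simplices by the factor `L / (L + 1)` in dimensions at
most `L`. -/
theorem affSd_single_mem (L : ℕ) {d : ℝ} (hd : 0 ≤ d) : ∀ {l : ℕ}, l ≤ L + 1 →
    ∀ v : Fin l → K, (∀ i j, dist (v i) (v j) ≤ d) →
    affSd hK l (Finsupp.single v 1) ∈ Finsupp.supported ℝ ℝ
      (smallTuples (Set.range fun i => (v i : E)) (L / (L + 1) * d) l)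
  | 0, _, v, _ => by
    rw [affSd, tupSd, LinearMap.id_apply]
    exact Finsupp.single_mem_supported ℝ _ ⟨fun i => i.elim0, fun i => i.elim0⟩
  | l + 1, hl, v, hv => by
    rw [affSd, tupSd_single, tupBdry_single, map_sum, map_sum]
    refine Submodule.sum_mem _ fun i _ => ?_
    rw [map_smul, map_smul]
    refine Submodule.smul_mem _ _ ?_
    refine linearMap_mem_of_mem_supported _ (fun w hw => ?_)
      (affSd_single_mem L hd (l := l) (by omega) (v ∘ i.succAbove) fun _ _ => hv _ _)
    have hρ : (l : ℝ) / (l + 1) ≤ L / (L + 1) := by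
      have : (l : ℝ) ≤ L := by exact_mod_cast (by omega : l ≤ L)
      rw [div_le_div_iff₀ (by positivity) (by positivity)]
      nlinarith
    have hw1 : ∀ k, (w k : E) ∈ convexHull ℝ (Set.range fun i => (v i : E)) := fun k =>
      convexHull_mono (by rintro _ ⟨j, rfl⟩; exact ⟨_, rfl⟩) (hw.1 k)
    have hb : ∀ k, dist (bary hK l v) (w k) ≤ L / (L + 1) * d := by
      intro k
      have hsub : convexHull ℝ (Set.range fun i => (v i : E)) ⊆
          Metric.closedBall (bary hK l v : E) (L / (L + 1) * d) := by
        refine convexHull_min ?_ (convex_closedBall _ _)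
        rintro _ ⟨j, rfl⟩
        rw [Metric.mem_closedBall, dist_comm]
        exact (dist_bary_le hK v hv j).trans (mul_le_mul_of_nonneg_right hρ hd)
      rw [dist_comm]
      exact hsub (hw1 k)
    rw [cone_single]
    refine Finsupp.single_mem_supported ℝ _ ⟨fun k => ?_, fun k k' => ?_⟩
    · refine Fin.cases ?_ (fun k => ?_) k
      · rw [Fin.cons_zero, bary, coe_affSimplex]
        exact (convex_convexHull ℝ _).sum_mem (fun i _ => stdSimplex.barycenter.2.1 i)
          stdSimplex.barycenter.2.2 fun i _ => subset_convexHull ℝ _ ⟨i, rfl⟩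
      · rw [Fin.cons_succ]
        exact hw1 k
    · refine Fin.cases ?_ (fun k => ?_) k <;> refine Fin.cases ?_ (fun k' => ?_) k'
      · simp only [dist_self]; positivity
      · simpa using hb k'
      · simpa [dist_comm] using hb k
      · simpa using hw.2 k k'

theorem affSd_iterate_mem {l : ℕ} {d : ℝ} (hd : 0 ≤ d) (v : Fin l → K)
    (hv : ∀ i j, dist (v i) (v j) ≤ d) (m : ℕ) :
    (affSd hK l ^ m) (Finsupp.single v 1) ∈ Finsupp.supported ℝ ℝ
      {w : Fin l → K | ∀ i j, dist (w i) (w j) ≤ ((l : ℝ) / (l + 1)) ^ m * d} := by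
  induction m with
  | zero =>
    refine Finsupp.single_mem_supported ℝ _ fun i j => ?_
    simpa using hv i j
  | succ m ih =>
    rw [pow_succ' (affSd hK l), Module.End.mul_apply]
    refine linearMap_mem_of_mem_supported _ (fun w hw => ?_) ih
    refine Finsupp.supported_mono ?_
      (affSd_single_mem hK l (mul_nonneg (by positivity) hd) (Nat.le_succ l) w hw)
    intro w' hw' i j
    rw [pow_succ', mul_assoc]
    exact hw'.2 i j

theorem singSd_pow_single {l : ℕ} (σ : C(Simp l, X)) (m : ℕ) :
    (singSd l ^ m) (Finsupp.single σ 1) = realize (convex_stdSimplex ℝ (Fin l)) σ l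
      ((affSd (convex_stdSimplex ℝ (Fin l)) l ^ m) (Finsupp.single (simpVertex l) 1)) := by
  induction m with
  | zero => simp [affSimplex_simpVertex]
  | succ m ih =>
    rw [pow_succ', Module.End.mul_apply, ih, singSd_realize, pow_succ', Module.End.mul_apply]

/-- Iterated subdivision makes a chain carried by `U ∪ V` small of order `{U, V}`. -/
theorem eventually_singSd_pow_mem {U V : Set X} (hU : IsOpen U) (hV : IsOpen V) {l : ℕ}
    {c : Sing X l} (hc : c ∈ carried (U ∪ V) l) :
    ∀ᶠ m in Filter.atTop, (singSd l ^ m) c ∈ carried U l ⊔ carried V l := by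
  have key : ∀ σ : C(Simp l, X), Set.range σ ⊆ U ∪ V → ∀ᶠ m in Filter.atTop,
      (singSd l ^ m) (Finsupp.single σ 1) ∈ carried U l ⊔ carried V l := by
    intro σ hσ
    -- Affine simplices smaller than a Lebesgue number of the cover of the simplex by the preimages
    -- of `U` and `V` are mapped into one of them.
    obtain ⟨δ, hδ, hδ'⟩ := lebesgue_number_lemma_of_metric (s := (Set.univ : Set (Simp l)))
      (c := fun b : Bool => if b then σ ⁻¹' U else σ ⁻¹' V) isCompact_univ
      (by
        rintro (_ | _)
        · exact hV.preimage σ.continuous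
        · exact hU.preimage σ.continuous)
      (by
        intro t _
        rcases hσ ⟨t, rfl⟩ with h | h
        · exact Set.mem_iUnion.2 ⟨true, h⟩
        · exact Set.mem_iUnion.2 ⟨false, h⟩)
    have hd : ∀ i j, dist (simpVertex l i) (simpVertex l j) ≤
        Metric.diam (Set.univ : Set (Simp l)) := fun i j =>
      Metric.dist_le_diam_of_mem isCompact_univ.isBounded trivial trivial
    have hlim : Filter.Tendsto
        (fun m : ℕ => ((l : ℝ) / (l + 1)) ^ m * Metric.diam (Set.univ : Set (Simp l)))
        Filter.atTop (𝓝 0) := by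
      have := (tendsto_pow_atTop_nhds_zero_of_lt_one (r := (l : ℝ) / (l + 1)) (by positivity)
        (by rw [div_lt_one (by positivity)]; linarith)).mul_const
          (Metric.diam (Set.univ : Set (Simp l)))
      simpa using this
    filter_upwards [hlim.eventually_lt_const hδ] with m hm
    rw [singSd_pow_single]
    refine linearMap_mem_of_mem_supported _ (fun w hw => ?_)
      (affSd_iterate_mem (convex_stdSimplex ℝ (Fin l)) Metric.diam_nonneg (simpVertex l) hd m)
    rw [realize_single]
    rcases Nat.eq_zero_or_pos l with rfl | hl
    · refine Submodule.mem_sup_left (Finsupp.single_mem_supported ℝ _ ?_)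
      rintro _ ⟨t, rfl⟩
      have := t.2.2
      simp at this
    · have hball : Set.range (affSimplex (convex_stdSimplex ℝ (Fin l)) w) ⊆
          Metric.ball (w ⟨0, hl⟩) δ := by
        rintro _ ⟨t, rfl⟩
        have : (affSimplex (convex_stdSimplex ℝ (Fin l)) w t).1 ∈
            Metric.ball (w ⟨0, hl⟩).1 δ := by
          rw [coe_affSimplex]
          refine (convex_ball _ _).sum_mem (fun i _ => t.2.1 i) t.2.2 fun i _ => ?_
          exact lt_of_le_of_lt (hw i _) hm
        exact this
      obtain ⟨b, hb⟩ := hδ' (w ⟨0, hl⟩) trivial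
      rcases b with _ | _
      · refine Submodule.mem_sup_right (Finsupp.single_mem_supported ℝ _ ?_)
        rintro _ ⟨t, rfl⟩
        exact hb (hball ⟨t, rfl⟩)
      · refine Submodule.mem_sup_left (Finsupp.single_mem_supported ℝ _ ?_)
        rintro _ ⟨t, rfl⟩
        exact hb (hball ⟨t, rfl⟩)
  have hall : ∀ᶠ m in Filter.atTop, ∀ σ ∈ c.support,
      (singSd l ^ m) (Finsupp.single σ 1) ∈ carried U l ⊔ carried V l :=
    (Filter.eventually_all_finset _).2 fun σ hσ => key σ (hc hσ)
  filter_upwards [hall] with m hm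
  exact linearMap_mem_of_mem_supported (s := (c.support : Set _)) _ hm fun _ h => h

/-- Iterated subdivision is chain homotopic to the identity, and the homotopy does not enlarge the
carrier of a chain. -/
theorem exists_singSd_pow_homotopy (m l : ℕ) :
    ∃ (p : Sing X (l + 1) →ₗ[ℝ] Sing X (l + 2)) (q : Sing X l →ₗ[ℝ] Sing X (l + 1)),
      (∀ c, bdry (l + 1) (p c) + q (bdry l c) = c - (singSd (l + 1) ^ m) c) ∧
      (∀ (S : Set X) (c), c ∈ carried S (l + 1) → p c ∈ carried S (l + 2)) ∧
      ∀ (S : Set X) (c), c ∈ carried S l → q c ∈ carried S (l + 1) := by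
  induction m with
  | zero => exact ⟨0, 0, by simp, by simp, by simp⟩
  | succ m ih =>
    obtain ⟨p, q, h, hp, hq⟩ := ih
    refine ⟨p ∘ₗ singSd (l + 1) + singSdHtpy (l + 1), q ∘ₗ singSd l + singSdHtpy l, fun c => ?_,
      fun S c hc => ?_, fun S c hc => ?_⟩
    · have h1 := h (singSd (l + 1) c)
      have h2 := bdry_singSdHtpy_add c
      rw [pow_succ, Module.End.mul_apply]
      simp only [LinearMap.add_apply, LinearMap.comp_apply, map_add]
      rw [bdry_singSd] at h1
      rw [add_add_add_comm, h1, h2]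
      abel
    · exact add_mem (hp S _ (singSd_mem_carried hc)) (singSdHtpy_mem_carried hc)
    · exact add_mem (hq S _ (singSd_mem_carried hc)) (singSdHtpy_mem_carried hc)

/-- The theorem of small chains: a chain of `U ∪ V` whose boundary is already small is, up to a
boundary, a sum of a chain of `U` and a chain of `V`. -/
theorem exists_eq_add_add_bdry {U V : Set X} (hU : IsOpen U) (hV : IsOpen V) {l : ℕ}
    {c : Sing X (l + 1)} (hc : c ∈ carried (U ∪ V) (l + 1))
    (hbc : bdry l c ∈ carried U l ⊔ carried V l) :
    ∃ a ∈ carried U (l + 1), ∃ b ∈ carried V (l + 1), ∃ y ∈ carried (U ∪ V) (l + 2),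
      c = a + b + bdry (l + 1) y := by
  obtain ⟨m, hm⟩ := (eventually_singSd_pow_mem hU hV hc).exists
  obtain ⟨p, q, h, hp, hq⟩ := exists_singSd_pow_homotopy (X := X) m l
  have hq' : q (bdry l c) ∈ carried U (l + 1) ⊔ carried V (l + 1) := by
    obtain ⟨a, ha, b, hb, hab⟩ := Submodule.mem_sup.1 hbc
    rw [← hab, map_add]
    exact Submodule.add_mem_sup (hq U a ha) (hq V b hb)
  obtain ⟨a, ha, b, hb, hab⟩ := Submodule.mem_sup.1 (add_mem hm hq')
  refine ⟨a, ha, b, hb, p c, hp _ _ hc, ?_⟩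
  rw [hab, add_assoc, add_comm (q _), h]
  abel

end Subdivision

/-! ### The prism operator -/

section Prism
variable {E : Type*} [NormedAddCommGroup E] [NormedSpace ℝ E] {K : Set E} (hK : Convex ℝ K)
variable {X Y : Type*} [TopologicalSpace X] [TopologicalSpace Y]

theorem convex_prism {K : Set E} (hK : Convex ℝ K) :
    Convex ℝ (K ×ˢ Set.Icc (0 : ℝ) 1) := hK.prod (convex_Icc 0 1)

/-- The copy of `K` at height `s` in `K × [0, 1]`. -/
def prismSlice (s : Set.Icc (0 : ℝ) 1) (x : K) : ↥(K ×ˢ Set.Icc (0 : ℝ) 1) :=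
  ⟨(x, s), x.2, s.2⟩

/-- The map `(x, s) ↦ H (F x, s)` on `K × [0, 1]`. -/
def prismFun (H : C(X × ℝ, Y)) (F : C(K, X)) : C(↥(K ×ˢ Set.Icc (0 : ℝ) 1), Y) where
  toFun p := H (F ⟨p.1.1, p.2.1⟩, p.1.2)
  continuous_toFun := by fun_prop

/-- The ordered chains of the prism `K × [0, 1]`, as a homotopy from bottom to top. -/
abbrev affPrism (l : ℕ) : Tup K l →ₗ[ℝ] Tup ↥(K ×ˢ Set.Icc (0 : ℝ) 1) (l + 1) :=
  coneOp (fun l => tupMap (prismSlice 1) l - tupMap (prismSlice 0) l)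
    (fun _ v => prismSlice 0 (v 0)) l

/-- The prism operator of `H`: a chain homotopy from `H (·, 0)` to `H (·, 1)`. -/
def singPrism (H : C(X × ℝ, Y)) (l : ℕ) : Sing X l →ₗ[ℝ] Sing Y (l + 1) :=
  Finsupp.linearCombination ℝ fun σ =>
    realize (convex_prism (convex_stdSimplex ℝ (Fin l))) (prismFun H σ) (l + 1)
      (affPrism l (Finsupp.single (simpVertex l) 1))

theorem singPrism_single (H : C(X × ℝ, Y)) {l : ℕ} (σ : C(Simp l, X)) :
    singPrism H l (Finsupp.single σ 1) =
      realize (convex_prism (convex_stdSimplex ℝ (Fin l))) (prismFun H σ) (l + 1)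
        (affPrism l (Finsupp.single (simpVertex l) 1)) := by
  simp [singPrism]

/-- The product of an affine simplex with the identity of `[0, 1]`. -/
def prismAff {m : ℕ} (w : Fin m → K) (p : ↥(Simp m ×ˢ Set.Icc (0 : ℝ) 1)) :
    ↥(K ×ˢ Set.Icc (0 : ℝ) 1) :=
  ⟨(affSimplex hK w ⟨p.1.1, p.2.1⟩, p.1.2), (affSimplex hK w ⟨p.1.1, p.2.1⟩).2, p.2.2⟩

theorem prismAff_affSimplex {l m : ℕ} (w : Fin m → K)
    (v : Fin l → ↥(Simp m ×ˢ Set.Icc (0 : ℝ) 1)) (t : Simp l) :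
    affSimplex (convex_prism hK) (prismAff hK w ∘ v) t =
      prismAff hK w (affSimplex (convex_prism (convex_stdSimplex ℝ (Fin m))) v t) := by
  refine Subtype.ext (Prod.ext ?_ ?_)
  · have h := congrArg Subtype.val
      (affSimplex_affSimplex hK w (fun i => ⟨(v i).1.1, (v i).2.1⟩) t)
    have e : (affSimplex (convex_stdSimplex ℝ (Fin m)) (fun i => ⟨(v i).1.1, (v i).2.1⟩) t) =
        ⟨(affSimplex (convex_prism (convex_stdSimplex ℝ (Fin m))) v t).1.1,
          (affSimplex (convex_prism (convex_stdSimplex ℝ (Fin m))) v t).2.1⟩ := by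
      refine Subtype.ext ?_
      simp only [coe_affSimplex, Prod.fst_sum, Prod.smul_fst]
    rw [e] at h
    simp only [prismAff]
    rw [h]
    simp only [coe_affSimplex, Prod.fst_sum, Prod.smul_fst, Function.comp_apply, prismAff]
  · simp only [coe_affSimplex, Prod.snd_sum, Prod.smul_snd, Function.comp_apply, prismAff]

theorem realize_tupMap_prismAff (H : C(X × ℝ, Y)) (F : C(K, X)) {l m : ℕ} (w : Fin m → K)
    (c : Tup ↥(Simp m ×ˢ Set.Icc (0 : ℝ) 1) l) :
    realize (convex_prism hK) (prismFun H F) l (tupMap (prismAff hK w) l c) =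
      realize (convex_prism (convex_stdSimplex ℝ (Fin m)))
        (prismFun H (F.comp (affSimplex hK w))) l c := by
  suffices h : realize (convex_prism hK) (prismFun H F) l ∘ₗ tupMap (prismAff hK w) l =
      realize (convex_prism (convex_stdSimplex ℝ (Fin m)))
        (prismFun H (F.comp (affSimplex hK w))) l from LinearMap.congr_fun h c
  refine Finsupp.lhom_ext' fun v => LinearMap.ext_ring ?_
  simp only [LinearMap.comp_apply, Finsupp.lsingle_apply, tupMap_single, realize_single]
  congr 1
  ext t
  exact congrArg (prismFun H F) (prismAff_affSimplex hK w v t)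

theorem singPrism_realize (H : C(X × ℝ, Y)) (F : C(K, X)) {l : ℕ} (c : Tup K l) :
    singPrism H l (realize hK F l c) =
      realize (convex_prism hK) (prismFun H F) (l + 1) (affPrism l c) := by
  suffices h : singPrism H l ∘ₗ realize hK F l =
      realize (convex_prism hK) (prismFun H F) (l + 1) ∘ₗ affPrism l from
    LinearMap.congr_fun h c
  refine Finsupp.lhom_ext' fun v => LinearMap.ext_ring ?_
  simp only [LinearMap.comp_apply, Finsupp.lsingle_apply, realize_single]
  rw [singPrism_single, ← realize_tupMap_prismAff]
  have key := coneOp_tupMap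
    (fun l => tupMap (prismSlice (K := Simp _) 1) l - tupMap (prismSlice 0) l)
    (fun _ v => prismSlice 0 (v 0))
    (fun l => tupMap (prismSlice (K := K) 1) l - tupMap (prismSlice 0) l)
    (fun _ v => prismSlice 0 (v 0)) (affSimplex hK v) (prismAff hK v) (fun _ _ => rfl)
    (by
      intro l c
      suffices h : (tupMap (prismSlice (K := K) 1) l - tupMap (prismSlice 0) l) ∘ₗ
          tupMap (affSimplex hK v) l = tupMap (prismAff hK v) l ∘ₗ
          (tupMap (prismSlice 1) l - tupMap (prismSlice 0) l) from LinearMap.congr_fun h c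
      refine Finsupp.lhom_ext' fun v => LinearMap.ext_ring ?_
      simp only [LinearMap.comp_apply, Finsupp.lsingle_apply, LinearMap.sub_apply, map_sub,
        tupMap_single]
      rfl)
    l (Finsupp.single (simpVertex l) 1)
  rw [affPrism, ← key, tupMap_single, affSimplex_comp_simpVertex]

/-- The slice of a homotopy at time `s`. -/
def timeSlice (H : C(X × ℝ, Y)) (s : ℝ) : C(X, Y) := ⟨fun x => H (x, s), by fun_prop⟩

theorem realize_tupMap_prismSlice (H : C(X × ℝ, Y)) (F : C(K, X)) (s : Set.Icc (0 : ℝ) 1) {l : ℕ}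
    (c : Tup K l) :
    realize (convex_prism hK) (prismFun H F) l (tupMap (prismSlice s) l c) =
      push (timeSlice H s) l (realize hK F l c) := by
  suffices h : realize (convex_prism hK) (prismFun H F) l ∘ₗ tupMap (prismSlice s) l =
      push (timeSlice H s) l ∘ₗ realize hK F l from LinearMap.congr_fun h c
  refine Finsupp.lhom_ext' fun v => LinearMap.ext_ring ?_
  simp only [LinearMap.comp_apply, Finsupp.lsingle_apply, tupMap_single, realize_single,
    push_single]
  congr 1
  ext t
  have : affSimplex (convex_prism hK) (prismSlice s ∘ v) t = prismSlice s (affSimplex hK v t) := by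
    refine Subtype.ext (Prod.ext ?_ ?_)
    · simp only [coe_affSimplex, Prod.fst_sum, Prod.smul_fst, Function.comp_apply, prismSlice]
    · simp only [coe_affSimplex, Prod.snd_sum, Prod.smul_snd, Function.comp_apply, prismSlice,
        ← Finset.sum_smul]
      rw [show ∑ i, t i = 1 from t.2.2, one_smul]
  simp only [ContinuousMap.comp_apply, this]
  rfl

theorem bdry_singPrism_add (H : C(X × ℝ, Y)) {l : ℕ} (c : Sing X (l + 1)) :
    bdry (l + 1) (singPrism H (l + 1) c) + singPrism H l (bdry l c) =
      push (timeSlice H 1) (l + 1) c - push (timeSlice H 0) (l + 1) c := by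
  suffices h : bdry (l + 1) ∘ₗ singPrism H (l + 1) + singPrism H l ∘ₗ bdry l =
      push (timeSlice H 1) (l + 1) - push (timeSlice H 0) (l + 1) from LinearMap.congr_fun h c
  refine Finsupp.lhom_ext' fun σ => LinearMap.ext_ring ?_
  simp only [LinearMap.comp_apply, Finsupp.lsingle_apply, LinearMap.add_apply,
    LinearMap.sub_apply]
  rw [← realize_simpVertex, bdry_realize, singPrism_realize, bdry_realize, singPrism_realize,
    ← map_add, tupBdry_coneOp_add_coneOp_tupBdry, LinearMap.sub_apply, map_sub,
    realize_tupMap_prismSlice, realize_tupMap_prismSlice]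
  · rfl
  · refine Finsupp.lhom_ext' fun v => LinearMap.ext_ring ?_
    simp only [LinearMap.comp_apply, Finsupp.lsingle_apply, LinearMap.sub_apply, tupMap_single,
      LinearMap.zero_apply]
    refine sub_eq_zero.2 (congrArg (fun w => Finsupp.single w 1) ?_)
    exact Subsingleton.elim _ _
  · intro l c
    simp [tupBdry_tupMap]

/-- The prism operator vanishes on the augmentation degree, whose elements have no vertex to be
moved. -/
theorem singPrism_zero (H : C(X × ℝ, Y)) (c : Sing X 0) : singPrism H 0 c = 0 := by
  suffices h : singPrism H 0 = 0 from LinearMap.congr_fun h c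
  refine Finsupp.lhom_ext' fun σ => LinearMap.ext_ring ?_
  simp [singPrism_single, affPrism, coneOp]

theorem singPrism_mem_carried {H : C(X × ℝ, Y)} {S : Set X} {T : Set Y}
    (h : ∀ x ∈ S, ∀ s ∈ Set.Icc (0 : ℝ) 1, H (x, s) ∈ T) {l : ℕ} {c : Sing X l}
    (hc : c ∈ carried S l) : singPrism H l c ∈ carried T (l + 1) := by
  refine linearMap_mem_of_mem_supported _ (fun σ hσ => ?_) hc
  rw [singPrism_single]
  refine realize_mem_carried _ ?_ _
  rintro _ ⟨p, rfl⟩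
  exact h _ (hσ ⟨_, rfl⟩) _ p.2.2

end Prism

/-! ### Relative homology and Mayer-Vietoris -/

section RelVanish
variable {X Y : Type*} [TopologicalSpace X] [TopologicalSpace Y]

/-- The relative homology of `(X, X ∖ A)` vanishes in degree `l`: every relative cycle is a
relative boundary. In degree zero the augmentation makes this a statement about reduced homology
when `A` is the whole space. -/
def RelVanish (l : ℕ) (A : Set X) : Prop :=
  ∀ z : Sing X (l + 1), bdry l z ∈ carried Aᶜ l →
    ∃ w : Sing X (l + 2), z - bdry (l + 1) w ∈ carried Aᶜ (l + 1)

theorem relVanish_empty (l : ℕ) : RelVanish l (∅ : Set X) := fun z _ =>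
  ⟨0, by rw [Set.compl_empty]; exact mem_carried_univ _⟩

/-- Mayer-Vietoris: vanishing for a union. -/
theorem RelVanish.union {l : ℕ} {A B : Set X} (hA : IsClosed A) (hB : IsClosed B)
    (h₁ : RelVanish l A) (h₂ : RelVanish l B) (h₁₂ : RelVanish (l + 1) (A ∩ B)) :
    RelVanish l (A ∪ B) := by
  intro z hz
  rw [Set.compl_union] at hz
  obtain ⟨wA, hwA⟩ := h₁ z (carried_mono Set.inter_subset_left _ hz)
  obtain ⟨wB, hwB⟩ := h₂ z (carried_mono Set.inter_subset_right _ hz)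
  have hsup : ∀ k, carried Aᶜ k ⊔ carried Bᶜ k ≤ carried (A ∩ B)ᶜ k := fun k => by
    rw [Set.compl_inter]
    exact sup_le (carried_mono Set.subset_union_left _) (carried_mono Set.subset_union_right _)
  -- `wB - wA` is a relative cycle for `A ∩ B`. Correcting it by a boundary makes it a chain of
  -- `Aᶜ ∪ Bᶜ`, which can be made small; the part in `Aᶜ` then corrects `wA`.
  have hw : bdry (l + 1) (wB - wA) ∈ carried Aᶜ (l + 1) ⊔ carried Bᶜ (l + 1) := by
    have : bdry (l + 1) (wB - wA) =
        (z - bdry (l + 1) wA) + -(z - bdry (l + 1) wB) := by rw [map_sub]; abel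
    rw [this]
    exact Submodule.add_mem_sup hwA (neg_mem hwB)
  obtain ⟨y, hy⟩ := h₁₂ _ (hsup _ hw)
  have hbs : bdry (l + 1) ((wB - wA) - bdry (l + 2) y) = bdry (l + 1) (wB - wA) := by
    rw [map_sub _ (wB - wA), bdry_bdry, sub_zero]
  rw [Set.compl_inter] at hy
  obtain ⟨a, ha, b, hb, y', -, hab⟩ :=
    exists_eq_add_add_bdry hA.isOpen_compl hB.isOpen_compl hy (by rw [hbs]; exact hw)
  rw [hab, map_add, map_add, bdry_bdry, add_zero, map_sub] at hbs
  refine ⟨wA + a, ?_⟩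
  rw [Set.compl_union, carried_inter]
  refine ⟨?_, ?_⟩
  · rw [map_add, ← sub_sub]
    exact sub_mem hwA (bdry_mem_carried ha)
  · have : z - bdry (l + 1) (wA + a) = (z - bdry (l + 1) wB) + bdry (l + 1) b := by
      rw [map_add, ← sub_eq_zero]
      have := sub_eq_zero.2 hbs
      rw [← neg_eq_zero, ← this]
      abel
    rw [this]
    exact add_mem hwB (bdry_mem_carried hb)

/-- Mayer-Vietoris: vanishing for an intersection. -/
theorem RelVanish.inter {l : ℕ} {A B : Set X} (hA : IsClosed A) (hB : IsClosed B)
    (h₁ : RelVanish (l + 1) A) (h₂ : RelVanish (l + 1) B) (h₁₂ : RelVanish l (A ∪ B)) :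
    RelVanish (l + 1) (A ∩ B) := by
  intro z hz
  rw [Set.compl_inter] at hz ⊢
  obtain ⟨a, ha, b, hb, y, hy, hab⟩ :=
    exists_eq_add_add_bdry hA.isOpen_compl hB.isOpen_compl hz (by rw [bdry_bdry]; exact zero_mem _)
  -- After the correction by `y`, the boundary of `z` is `a + b`, and `a` is a relative cycle for
  -- `A ∪ B`. So `a` is, up to `Aᶜ ∩ Bᶜ`, the boundary of a chain `e`, and `z - y` is the sum of
  -- `e`, a relative cycle for `A`, and `z - y - e`, a relative cycle for `B`.
  have hcyc : bdry l a = -bdry l b := by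
    have := bdry_bdry z
    rw [hab, map_add, map_add, bdry_bdry, add_zero] at this
    exact eq_neg_of_add_eq_zero_left this
  obtain ⟨e, he⟩ := h₁₂ a (by
    rw [Set.compl_union, carried_inter]
    refine ⟨bdry_mem_carried ha, ?_⟩
    rw [hcyc]
    exact neg_mem (bdry_mem_carried hb))
  rw [Set.compl_union, carried_inter] at he
  obtain ⟨w₁, hw₁⟩ := h₁ e (by
    have := sub_mem ha he.1
    rwa [sub_sub_cancel] at this)
  obtain ⟨w₂, hw₂⟩ := h₂ (z - y - e) (by
    have : bdry (l + 1) (z - y - e) = b + (a - bdry (l + 1) e) := by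
      rw [map_sub, map_sub, hab]; abel
    rw [this]
    exact add_mem hb he.2)
  refine ⟨w₁ + w₂, ?_⟩
  have : z - bdry (l + 1 + 1) (w₁ + w₂) =
      y + ((e - bdry (l + 2) w₁) + (z - y - e - bdry (l + 2) w₂)) := by
    rw [map_add]; abel
  rw [this]
  exact add_mem hy (add_mem (carried_mono Set.subset_union_left _ hw₁)
    (carried_mono Set.subset_union_right _ hw₂))

/-- If the relative homology of all members of a family of closed sets that is stable under
intersections vanishes above degree `n`, then so does that of their finite unions. -/
theorem relVanish_biUnion {n : ℕ} (𝓕 : Set (Set X)) (hcl : ∀ A ∈ 𝓕, IsClosed A)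
    (hinter : ∀ A ∈ 𝓕, ∀ B ∈ 𝓕, A ∩ B ∈ 𝓕) (hvan : ∀ A ∈ 𝓕, ∀ l, n < l → RelVanish l A)
    {ι : Type*} (s : Finset ι) (f : ι → Set X) (hf : ∀ i ∈ s, f i ∈ 𝓕) :
    ∀ l, n < l → RelVanish l (⋃ i ∈ s, f i) := by
  classical
  induction s using Finset.induction_on generalizing f with
  | empty => intro l _; simpa using relVanish_empty l
  | insert i s his ih =>
    intro l hl
    rw [Finset.set_biUnion_insert]
    have hi : f i ∈ 𝓕 := hf i (Finset.mem_insert_self _ _)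
    have hs : ∀ j ∈ s, f j ∈ 𝓕 := fun j hj => hf j (Finset.mem_insert_of_mem hj)
    refine RelVanish.union (hcl _ hi) ?_ (hvan _ hi l hl) (ih f hs l hl) ?_
    · exact s.finite_toSet.isClosed_biUnion fun j hj => hcl _ (hs j hj)
    · rw [Set.inter_iUnion₂]
      exact ih (fun j => f i ∩ f j) (fun j hj => hinter _ hi _ (hs j hj)) (l + 1) (by omega)

end RelVanish

/-! ### Vanishing for compact subsets of `ℝⁿ` -/

section Vanishing
variable {X Y : Type*} [TopologicalSpace X] [TopologicalSpace Y]

/-- The union of the images of the simplices of a chain. -/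
def chainSupport {l : ℕ} (c : Sing X l) : Set X := ⋃ σ ∈ c.support, Set.range σ

theorem isCompact_chainSupport {l : ℕ} (c : Sing X l) : IsCompact (chainSupport c) :=
  c.support.finite_toSet.isCompact_biUnion fun σ _ => isCompact_range σ.continuous

theorem mem_carried_iff {l : ℕ} {c : Sing X l} {S : Set X} :
    c ∈ carried S l ↔ chainSupport c ⊆ S := by
  rw [chainSupport, Set.iUnion₂_subset_iff]
  exact Iff.rfl

theorem carried_empty (l : ℕ) : carried (∅ : Set X) (l + 1) = ⊥ := by
  have : {σ : C(Simp (l + 1), X) | Set.range σ ⊆ ∅} = ∅ := by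
    ext σ
    simp only [Set.mem_ofPred_eq, Set.mem_empty_iff_false, iff_false]
    intro h
    exact h ⟨simpVertex (l + 1) 0, rfl⟩
  rw [carried, this, Finsupp.supported_empty]

theorem bdry_single_const {l : ℕ} (x : X) (r : ℝ) :
    bdry l (Finsupp.single (ContinuousMap.const _ x) r) =
      Finsupp.single (ContinuousMap.const _ x) (r * ∑ i : Fin (l + 1), (-1 : ℝ) ^ (i : ℕ)) := by
  rw [bdry, Finsupp.linearCombination_single]
  simp only [ContinuousMap.const_comp, Finsupp.smul_single, smul_eq_mul, mul_one,
    ← Finsupp.single_finsetSum, Finset.mul_sum]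

theorem push_const {l : ℕ} (y : Y) (c : Sing X l) :
    ∃ r, push (ContinuousMap.const X y) l c = Finsupp.single (ContinuousMap.const _ y) r := by
  induction c using Finsupp.induction_linear with
  | zero => exact ⟨0, by simp⟩
  | add f g hf hg =>
    obtain ⟨r, hr⟩ := hf
    obtain ⟨s, hs⟩ := hg
    exact ⟨r + s, by rw [map_add, hr, hs, Finsupp.single_add]⟩
  | single σ r => exact ⟨r, by rw [push_single, ContinuousMap.const_comp]⟩

/-- Chains pushed to a point bound if they are cycles of positive degree. -/
theorem exists_bdry_eq_push_const {l : ℕ} (y : Y) {c : Sing X (l + 2)} (hc : bdry (l + 1) c = 0) :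
    ∃ w, bdry (l + 2) w = push (ContinuousMap.const X y) (l + 2) c := by
  obtain ⟨r, hr⟩ := push_const y c
  have h := bdry_push (ContinuousMap.const X y) c
  rw [hc, map_zero, hr, bdry_single_const, Finsupp.single_eq_zero] at h
  rw [hr]
  rcases mul_eq_zero.1 h with rfl | h
  · exact ⟨0, by simp⟩
  · -- The alternating sums over `l + 2` and `l + 3` terms cannot both vanish.
    have h' : ∑ i : Fin (l + 3), (-1 : ℝ) ^ (i : ℕ) = (-1) ^ (l + 2) := by
      rw [Fin.sum_univ_castSucc]
      simp only [Fin.val_castSucc, Fin.val_last]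
      rw [h, zero_add]
    refine ⟨Finsupp.single (ContinuousMap.const _ y) (r * (-1) ^ (l + 2)), ?_⟩
    rw [bdry_single_const, h', mul_assoc, ← mul_pow]
    simp

/-- A real topological vector space has no homology in positive degrees. -/
theorem relVanish_univ {V : Type*} [AddCommGroup V] [Module ℝ V] [TopologicalSpace V]
    [ContinuousSMul ℝ V] (l : ℕ) : RelVanish (l + 1) (Set.univ : Set V) := by
  intro z hz
  rw [Set.compl_univ, carried_empty, Submodule.mem_bot] at hz
  let H : C(V × ℝ, V) := ⟨fun p => p.2 • p.1, by fun_prop⟩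
  have h0 : timeSlice H 0 = ContinuousMap.const V 0 := by ext x; simp [timeSlice, H]
  have h1 : timeSlice H 1 = ContinuousMap.id V := by ext x; simp [timeSlice, H]
  obtain ⟨w, hw⟩ := exists_bdry_eq_push_const (0 : V) hz
  have h := bdry_singPrism_add H z
  rw [hz, map_zero, add_zero, h0, h1, push_id, ← hw] at h
  refine ⟨singPrism H (l + 2) z + w, ?_⟩
  rw [map_add, h]
  simp

/-- If the translations by `s • u`, `s ≥ 0`, preserve the complement of `A` and move every compact
set into it, then `A` has no relative homology at all. -/
theorem relVanish_of_translation {V : Type*} [AddCommGroup V] [Module ℝ V] [TopologicalSpace V]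
    [ContinuousSMul ℝ V] [ContinuousAdd V] {A : Set V} (u : V)
    (hA : ∀ (x : V) (s : ℝ), 0 ≤ s → x + s • u ∈ A → x ∈ A)
    (hR : ∀ L : Set V, IsCompact L → ∃ R : ℝ, 0 ≤ R ∧ ∀ x ∈ L, x + R • u ∉ A) (l : ℕ) :
    RelVanish l A := by
  intro z hz
  obtain ⟨R, hR0, hR⟩ := hR _ (isCompact_chainSupport z)
  let H : C(V × ℝ, V) := ⟨fun p => p.1 + (p.2 * R) • u, by fun_prop⟩
  have h0 : timeSlice H 0 = ContinuousMap.id V := by ext x; simp [timeSlice, H]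
  have h := bdry_singPrism_add H z
  rw [h0, push_id] at h
  refine ⟨-singPrism H (l + 1) z, ?_⟩
  have : z - bdry (l + 1) (-singPrism H (l + 1) z) =
      push (timeSlice H 1) (l + 1) z - singPrism H l (bdry l z) := by
    rw [map_neg, sub_neg_eq_add, eq_sub_iff_add_eq, add_assoc, h]
    abel
  rw [this]
  refine sub_mem (push_mem_carried ?_ (mem_carried_iff.2 subset_rfl))
    (singPrism_mem_carried (S := Aᶜ) (T := Aᶜ)
      (fun x hx s hs h => hx (hA x _ (mul_nonneg hs.1 hR0) h)) hz)
  intro x hx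
  simpa [timeSlice, H] using hR x hx

/-- The generalized box with lower bounds in the coordinates `S` and upper bounds in the
coordinates `T`. -/
def halfBox {n : ℕ} (a b : Fin n → ℝ) (S T : Finset (Fin n)) : Set (Fin n → ℝ) :=
  {x | (∀ i ∈ S, a i ≤ x i) ∧ ∀ i ∈ T, x i ≤ b i}

theorem isClosed_halfBox {n : ℕ} (a b : Fin n → ℝ) (S T : Finset (Fin n)) :
    IsClosed (halfBox a b S T) := by
  have : halfBox a b S T = (⋂ i ∈ S, {x | a i ≤ x i}) ∩ ⋂ i ∈ T, {x | x i ≤ b i} := by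
    ext x
    simp [halfBox]
  rw [this]
  exact (isClosed_biInter fun i _ => isClosed_le continuous_const (continuous_apply i)).inter
    (isClosed_biInter fun i _ => isClosed_le (continuous_apply i) continuous_const)

theorem exists_coord_bound {n : ℕ} {L : Set (Fin n → ℝ)} (hL : IsCompact L) (i : Fin n) :
    ∃ R : ℝ, 0 ≤ R ∧ ∀ x ∈ L, |x i| ≤ R := by
  obtain ⟨R, hR⟩ := hL.isBounded.exists_norm_le
  exact ⟨max R 0, le_max_right _ _, fun x hx =>
    ((norm_le_pi_norm x i).trans (hR x hx)).trans (le_max_left _ _)⟩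

/-- A generalized box that is a half-line in some coordinate has no relative homology. -/
theorem relVanish_halfBox_of_left {n : ℕ} (a b : Fin n → ℝ) {S T : Finset (Fin n)} {i : Fin n}
    (hS : i ∈ S) (hT : i ∉ T) (l : ℕ) : RelVanish l (halfBox a b S T) := by
  refine relVanish_of_translation (A := halfBox a b S T) (-Pi.single i 1)
    (fun x s hs hx' => ⟨?_, ?_⟩) ?_ l
  · intro j hj
    refine (hx'.1 j hj).trans ?_
    by_cases h : j = i
    · subst h; simpa using hs
    · simp [h]
  · intro j hj
    have h : j ≠ i := fun h => hT (h ▸ hj)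
    simpa [h] using hx'.2 j hj
  · intro L hL
    obtain ⟨R, hR0, hR⟩ := exists_coord_bound hL i
    refine ⟨R + |a i| + 1, by positivity, fun x hx hx' => ?_⟩
    have h1 := hx'.1 i hS
    have h2 := (abs_le.1 (hR x hx)).2
    have h3 := neg_abs_le (a i)
    simp only [Pi.add_apply, Pi.smul_apply, Pi.neg_apply, Pi.single_eq_same, smul_eq_mul] at h1
    linarith

theorem relVanish_halfBox_of_right {n : ℕ} (a b : Fin n → ℝ) {S T : Finset (Fin n)} {i : Fin n}
    (hS : i ∉ S) (hT : i ∈ T) (l : ℕ) : RelVanish l (halfBox a b S T) := by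
  refine relVanish_of_translation (A := halfBox a b S T) (Pi.single i 1)
    (fun x s hs hx' => ⟨?_, ?_⟩) ?_ l
  · intro j hj
    have h : j ≠ i := fun h => hS (h ▸ hj)
    simpa [h] using hx'.1 j hj
  · intro j hj
    refine le_trans ?_ (hx'.2 j hj)
    by_cases h : j = i
    · subst h; simpa using hs
    · simp [h]
  · intro L hL
    obtain ⟨R, hR0, hR⟩ := exists_coord_bound hL i
    refine ⟨R + |b i| + 1, by positivity, fun x hx hx' => ?_⟩
    have h1 := hx'.2 i hT
    have h2 := (abs_le.1 (hR x hx)).1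
    have h3 := le_abs_self (b i)
    simp only [Pi.add_apply, Pi.smul_apply, Pi.single_eq_same, smul_eq_mul] at h1
    linarith

/-- A product of compact intervals and lines has no relative homology above the number of its
compact factors. -/
theorem relVanish_halfBox_self {n : ℕ} {a b : Fin n → ℝ} (hab : ∀ i, a i ≤ b i)
    (S : Finset (Fin n)) : ∀ l, S.card < l → RelVanish l (halfBox a b S S) := by
  induction S using Finset.induction_on with
  | empty =>
    intro l hl
    obtain ⟨l, rfl⟩ := Nat.exists_eq_succ_of_ne_zero (by omega : l ≠ 0)
    have : halfBox a b ∅ ∅ = Set.univ := by ext; simp [halfBox]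
    rw [this]
    exact relVanish_univ l
  | insert i S hi ih =>
    intro l hl
    rw [Finset.card_insert_of_notMem hi] at hl
    obtain ⟨l, rfl⟩ := Nat.exists_eq_succ_of_ne_zero (by omega : l ≠ 0)
    have h1 : halfBox a b (insert i S) (insert i S) =
        halfBox a b (insert i S) S ∩ halfBox a b S (insert i S) := by
      ext x
      simp only [halfBox, Finset.forall_mem_insert, Set.mem_inter_iff, Set.mem_ofPred_eq]
      tauto
    have h2 : halfBox a b (insert i S) S ∪ halfBox a b S (insert i S) = halfBox a b S S := by
      ext x
      have : a i ≤ x i ∨ x i ≤ b i := (le_total (a i) (x i)).imp_right fun h => h.trans (hab i)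
      simp only [halfBox, Finset.forall_mem_insert, Set.mem_union, Set.mem_ofPred_eq]
      tauto
    rw [h1]
    refine RelVanish.inter (isClosed_halfBox _ _ _ _) (isClosed_halfBox _ _ _ _)
      (relVanish_halfBox_of_left a b (Finset.mem_insert_self i S) hi _)
      (relVanish_halfBox_of_right a b hi (Finset.mem_insert_self i S) _) ?_
    rw [h2]
    exact ih l (by omega)

theorem relVanish_Icc {n : ℕ} (a b : Fin n → ℝ) {l : ℕ} (hl : n < l) :
    RelVanish l (Set.Icc a b) := by
  by_cases hab : a ≤ b
  · have : Set.Icc a b = halfBox a b Finset.univ Finset.univ := by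
      ext x; simp [halfBox, Pi.le_def]
    rw [this]
    exact relVanish_halfBox_self hab _ l (by simpa using hl)
  · rw [Set.Icc_eq_empty hab]
    exact relVanish_empty l

/-- A compact subset of `ℝⁿ` has no relative homology above degree `n`. -/
theorem relVanish_of_isCompact_pi {n : ℕ} {K : Set (Fin n → ℝ)} (hK : IsCompact K) {l : ℕ}
    (hl : n < l) : RelVanish l K := by
  intro z hz
  have hdisj : ∀ x ∈ K, ∃ r > 0, Metric.closedBall x r ⊆ (chainSupport (bdry l z))ᶜ := by
    intro x hx
    refine Metric.nhds_basis_closedBall.mem_iff.1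
      ((isCompact_chainSupport _).isClosed.isOpen_compl.mem_nhds fun h => ?_)
    exact mem_carried_iff.1 hz h hx
  choose! r hr0 hr using hdisj
  obtain ⟨t, htK, ht⟩ := hK.elim_nhds_subcover (fun x => Metric.closedBall x (r x))
    fun x hx => Metric.closedBall_mem_nhds x (hr0 x hx)
  have hvan : RelVanish l (⋃ x ∈ t, Metric.closedBall x (r x)) := by
    refine relVanish_biUnion (Set.range fun p : (Fin n → ℝ) × (Fin n → ℝ) => Set.Icc p.1 p.2)
      ?_ ?_ ?_ t _ ?_ l hl
    · rintro _ ⟨p, rfl⟩; exact isClosed_Icc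
    · rintro _ ⟨p, rfl⟩ _ ⟨q, rfl⟩
      exact ⟨(p.1 ⊔ q.1, p.2 ⊓ q.2), Set.Icc_inter_Icc.symm⟩
    · rintro _ ⟨p, rfl⟩ l hl
      exact relVanish_Icc _ _ hl
    · intro x hx
      refine ⟨(fun i => x i - r x, fun i => x i + r x), ?_⟩
      simp only [closedBall_pi _ (hr0 x (htK x hx)).le, ← Set.pi_univ_Icc, Real.closedBall_eq_Icc]
  obtain ⟨w, hw⟩ := hvan z (mem_carried_iff.2 fun x hx hx' => by
    obtain ⟨y, hy, hxy⟩ := Set.mem_iUnion₂.1 hx'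
    exact hr y (htK y hy) hxy hx)
  exact ⟨w, carried_mono (Set.compl_subset_compl.2 ht) _ hw⟩

/-! ### Excision -/

theorem exists_push_eq {f : C(X, Y)} (hf : IsEmbedding f) {l : ℕ} {c : Sing Y l}
    (hc : c ∈ carried (Set.range f) l) : ∃ c', push f l c' = c := by
  have : c ∈ LinearMap.range (push f l) := by
    refine linearMap_mem_of_mem_supported LinearMap.id (fun σ hσ => ?_) hc
    choose g hg using fun t => hσ ⟨t, rfl⟩
    refine ⟨Finsupp.single ⟨g, hf.continuous_iff.2 ?_⟩ 1, ?_⟩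
    · exact σ.continuous.congr fun t => (hg t).symm
    · rw [push_single]
      congr 1
      exact ContinuousMap.ext hg
  exact this

theorem mem_carried_preimage {f : C(X, Y)} (hf : Function.Injective f) {S : Set Y} {l : ℕ}
    {c : Sing X l} : c ∈ carried (f ⁻¹' S) l ↔ push f l c ∈ carried S l := by
  refine ⟨push_mem_carried (Set.mapsTo_preimage f S), fun h => ?_⟩
  intro σ hσ
  have hinj : Function.Injective fun σ : C(Simp l, X) => f.comp σ := fun _ _ h =>
    ContinuousMap.ext fun t => hf (DFunLike.congr_fun h t)
  have h' : f.comp σ ∈ (push f l c).support := by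
    rw [Finsupp.mem_support_iff, push, Finsupp.lmapDomain_apply,
      Finsupp.mapDomain_apply hinj]
    exact Finsupp.mem_support_iff.1 hσ
  rintro _ ⟨t, rfl⟩
  exact h h' ⟨t, rfl⟩

/-- Excision: relative homology at `K` vanishes if it does in an open neighborhood of `K`. -/
theorem relVanish_of_preimage {f : C(X, Y)} (hf : IsOpenEmbedding f) {K : Set Y}
    (hK : IsClosed K) (hKf : K ⊆ Set.range f) {l : ℕ} (h : RelVanish l (f ⁻¹' K)) :
    RelVanish l K := by
  intro z hz
  have huniv : Set.range f ∪ Kᶜ = Set.univ :=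
    Set.eq_univ_of_forall fun y => (em (y ∈ K)).imp (fun h => hKf h) id
  obtain ⟨a, ha, b, hb, y, -, hab⟩ := exists_eq_add_add_bdry hf.isOpen_range hK.isOpen_compl
    (c := z) (by rw [huniv]; exact mem_carried_univ _) (Submodule.mem_sup_right hz)
  obtain ⟨a, rfl⟩ := exists_push_eq hf.isEmbedding ha
  obtain ⟨w, hw⟩ := h a (by
    rw [← Set.preimage_compl, mem_carried_preimage hf.injective, ← bdry_push]
    have := sub_mem hz (bdry_mem_carried hb)
    rw [hab, map_add, map_add, bdry_bdry] at this
    simpa using this)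
  rw [← Set.preimage_compl, mem_carried_preimage hf.injective, map_sub, ← bdry_push] at hw
  refine ⟨y + push f _ w, ?_⟩
  have : z - bdry (l + 1) (y + push f _ w) =
      (push f (l + 1) a - bdry (l + 1) (push f (l + 2) w)) + b := by
    rw [hab, map_add]; abel
  rw [this]
  exact add_mem hw hb

/-- Excision: relative homology at `K` vanishes in every open neighborhood of `K` if it does in the
whole space. -/
theorem RelVanish.preimage {f : C(X, Y)} (hf : IsOpenEmbedding f) {K : Set Y}
    (hK : IsClosed K) (hKf : K ⊆ Set.range f) {l : ℕ} (h : RelVanish l K) :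
    RelVanish l (f ⁻¹' K) := by
  intro z hz
  have huniv : Set.range f ∪ Kᶜ = Set.univ :=
    Set.eq_univ_of_forall fun y => (em (y ∈ K)).imp (fun h => hKf h) id
  rw [← Set.preimage_compl, mem_carried_preimage hf.injective, ← bdry_push] at hz
  obtain ⟨w, hw⟩ := h _ hz
  have hpz : push f (l + 1) z ∈ carried (Set.range f) (l + 1) :=
    push_mem_carried (fun x _ => Set.mem_range_self x) (mem_carried_univ z)
  obtain ⟨a, ha, b, hb, y, -, hab⟩ := exists_eq_add_add_bdry hf.isOpen_range hK.isOpen_compl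
    (c := w) (by rw [huniv]; exact mem_carried_univ _) (by
      have : bdry (l + 1) w = push f (l + 1) z + -(push f (l + 1) z - bdry (l + 1) w) := by abel
      rw [this]
      exact Submodule.add_mem_sup hpz (neg_mem hw))
  obtain ⟨a, rfl⟩ := exists_push_eq hf.isEmbedding ha
  refine ⟨a, ?_⟩
  rw [← Set.preimage_compl, mem_carried_preimage hf.injective, map_sub, ← bdry_push]
  have := add_mem hw (bdry_mem_carried hb)
  rw [hab, map_add, map_add, bdry_bdry] at this
  convert this using 1
  abel

/-! ### Manifolds -/

/-- Charts identify the source of `e` with an open subset of `ℝⁿ`; excision is used on both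
sides. -/
theorem relVanish_of_subset_chart {n : ℕ} [T2Space X] {K : Set X} (hK : IsCompact K)
    (e : OpenPartialHomeomorph X (EuclideanSpace ℝ (Fin n))) (hKe : K ⊆ e.source) {l : ℕ}
    (hl : n < l) : RelVanish l K := by
  let f : C(e.source, X) := ⟨Subtype.val, continuous_subtype_val⟩
  have hf : IsOpenEmbedding f := e.open_source.isOpenEmbedding_subtypeVal
  have hfK : IsCompact (f ⁻¹' K) :=
    hf.isInducing.isCompact_preimage' hK (by simpa [f] using hKe)
  have hg' := (EuclideanSpace.equiv (Fin n) ℝ).toHomeomorph.isOpenEmbedding.comp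
    e.isOpenEmbedding_restrict
  let g : C(e.source, Fin n → ℝ) := ⟨_, hg'.continuous⟩
  have hg : IsOpenEmbedding g := hg'
  refine relVanish_of_preimage hf hK.isClosed (by simpa [f] using hKe) ?_
  have hgK := hfK.image g.continuous
  have := RelVanish.preimage hg hgK.isClosed (Set.image_subset_range _ _)
    (relVanish_of_isCompact_pi hgK hl)
  rwa [Set.preimage_image_eq _ hg.injective] at this

/-- A compact `n`-manifold has no homology above degree `n`. -/
theorem exists_bdry_eq_of_compact_manifold {n : ℕ} [T2Space X] [CompactSpace X]
    [ChartedSpace (EuclideanSpace ℝ (Fin n)) X] {l : ℕ} (hl : n < l) {z : Sing X (l + 1)}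
    (hz : bdry l z = 0) : ∃ w, bdry (l + 1) w = z := by
  have hnhds : ∀ x : X, ∃ K ∈ 𝓝 x, IsCompact K ∧
      K ⊆ (chartAt (EuclideanSpace ℝ (Fin n)) x).source := by
    intro x
    obtain ⟨K, hK, hKs, hKc⟩ := local_compact_nhds
      ((chartAt (EuclideanSpace ℝ (Fin n)) x).open_source.mem_nhds (mem_chart_source _ x))
    exact ⟨K, hK, hKc, hKs⟩
  choose K hKn hKc hKs using hnhds
  obtain ⟨t, -, ht⟩ := isCompact_univ.elim_nhds_subcover K fun x _ => hKn x
  have hvan := relVanish_biUnion (n := n)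
    {A : Set X | IsCompact A ∧ ∃ x : X, A ⊆ (chartAt (EuclideanSpace ℝ (Fin n)) x).source}
    (fun A hA => hA.1.isClosed)
    (fun A hA B hB => ⟨hA.1.inter hB.1, hA.2.imp fun _ h => Set.inter_subset_left.trans h⟩)
    (fun A hA l hl => by
      obtain ⟨hA, x, hx⟩ := hA
      exact relVanish_of_subset_chart hA _ hx hl)
    t K (fun x _ => ⟨hKc x, x, hKs x⟩) l hl
  rw [Set.univ_subset_iff.1 ht] at hvan
  obtain ⟨w, hw⟩ := hvan z (by rw [hz]; exact zero_mem _)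
  rw [Set.compl_univ, carried_empty, Submodule.mem_bot] at hw
  exact ⟨w, (sub_eq_zero.1 hw).symm⟩

end Vanishing

/-! ### The covering of `N × S¹` by `N × ℝ` -/

section CircleFactor
variable {N : Type*} [TopologicalSpace N]

/-- The covering `N × ℝ → N × S¹`. -/
def cover (N : Type*) [TopologicalSpace N] : C(N × ℝ, N × Circle) :=
  ⟨fun p => (p.1, Circle.exp p.2), by fun_prop⟩

/-- The translation by `a` in the second factor of `N × ℝ`. -/
def shift (N : Type*) [TopologicalSpace N] (a : ℝ) : C(N × ℝ, N × ℝ) :=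
  ⟨fun p => (p.1, p.2 + a), by fun_prop⟩

/-- The map `(x, z) ↦ (x, z ^ d)` of `N × S¹`. -/
def circlePow (N : Type*) [TopologicalSpace N] (d : ℕ) : C(N × Circle, N × Circle) :=
  ⟨fun p => (p.1, p.2 ^ d), by fun_prop⟩

/-- The lift `(x, t) ↦ (x, d t)` of `circlePow N d` to `N × ℝ`. -/
def scale (N : Type*) [TopologicalSpace N] (d : ℕ) : C(N × ℝ, N × ℝ) :=
  ⟨fun p => (p.1, d * p.2), by fun_prop⟩

theorem shift_comp_shift (a b : ℝ) : (shift N a).comp (shift N b) = shift N (b + a) := by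
  ext p <;> simp [shift, add_assoc]

theorem cover_comp_shift (j : ℤ) : (cover N).comp (shift N (j * (2 * Real.pi))) = cover N := by
  ext p <;> simp [cover, shift, Circle.exp_add]

theorem cover_comp_scale (d : ℕ) :
    (cover N).comp (scale N d) = (circlePow N d).comp (cover N) := by
  ext p
  · rfl
  · simp only [cover, scale, circlePow, ContinuousMap.comp_apply, ContinuousMap.coe_mk]
    rw [← nsmul_eq_mul, Circle.exp_nsmul]

theorem scale_comp_shift (d : ℕ) (a : ℝ) :
    (scale N d).comp (shift N a) = (shift N (d * a)).comp (scale N d) := by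
  ext p <;> simp [shift, scale, mul_add]

/-- Singular simplices lift to `N × ℝ`: a simplex contracts to a vertex, and this homotopy is
lifted. -/
theorem exists_lift_simplex {l : ℕ} (σ : C(Simp l, N × Circle)) :
    ∃ σ' : C(Simp l, N × ℝ), (cover N).comp σ' = σ := by
  rcases l with _ | l
  · have : IsEmpty (Simp 0) := ⟨fun t => by simpa using t.2.2⟩
    exact ⟨⟨fun t => isEmptyElim t, continuous_of_discreteTopology⟩,
      ContinuousMap.ext fun t => isEmptyElim t⟩
  · let v := simpVertex (l + 1) 0
    let H : C(unitInterval × Simp (l + 1), Circle) :=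
      ⟨fun p => (σ ⟨(1 - p.1.1) • v.1 + p.1.1 • p.2.1, convex_stdSimplex ℝ _ v.2 p.2.2
        (sub_nonneg.2 p.1.2.2) p.1.2.1 (by ring)⟩).2, by fun_prop⟩
    obtain ⟨t₀, ht₀⟩ : ∃ t, Circle.exp t = (σ v).2 := ⟨_, Circle.exp_arg _⟩
    have H0 : ∀ t, H (0, t) = Circle.exp (ContinuousMap.const (Simp (l + 1)) t₀ t) := by
      intro t
      simp only [ContinuousMap.const_apply, ht₀, H, ContinuousMap.coe_mk]
      congr 2
      ext; simp
    let L := Circle.isCoveringMap_exp.liftHomotopy H (ContinuousMap.const _ t₀) H0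
    have hL : ∀ t, Circle.exp (L (1, t)) = (σ t).2 := by
      intro t
      have := congrFun (Circle.isCoveringMap_exp.liftHomotopy_lifts H _ H0) (1, t)
      refine this.trans ?_
      simp only [H, ContinuousMap.coe_mk]
      congr 2
      ext; simp
    refine ⟨⟨fun t => ((σ t).1, L (1, t)), by fun_prop⟩, ContinuousMap.ext fun t => ?_⟩
    exact Prod.ext rfl (hL t)

/-- Two lifts of a singular simplex differ by a deck transformation. -/
theorem exists_shift_eq {l : ℕ} {σ σ' : C(Simp l, N × ℝ)}
    (h : (cover N).comp σ = (cover N).comp σ') :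
    ∃ j : ℤ, σ' = (shift N (j * (2 * Real.pi))).comp σ := by
  rcases l with _ | l
  · have : IsEmpty (Simp 0) := ⟨fun t => by simpa using t.2.2⟩
    exact ⟨0, ContinuousMap.ext fun t => isEmptyElim t⟩
  · have h0 : ∀ t, cover N (σ t) = cover N (σ' t) := fun t => DFunLike.congr_fun h t
    have h1 : ∀ t, (σ t).1 = (σ' t).1 := fun t => (Prod.ext_iff.1 (h0 t)).1
    have h2 : ∀ t, Circle.exp (σ t).2 = Circle.exp (σ' t).2 := fun t => (Prod.ext_iff.1 (h0 t)).2
    let v := simpVertex (l + 1) 0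
    obtain ⟨j, hj⟩ := Circle.exp_eq_exp.1 (h2 v).symm
    refine ⟨j, ?_⟩
    have h3 := Circle.isCoveringMap_exp.eq_of_comp_eq (g₁ := fun t => (σ' t).2)
      (g₂ := fun t => (σ t).2 + j * (2 * Real.pi)) (by fun_prop) (by fun_prop)
      (by
        funext t
        simp only [Function.comp_apply]
        rw [← h2, Circle.exp_add, Circle.exp_int_mul_two_pi, mul_one]) v hj
    ext t
    · exact (h1 t).symm
    · exact congrFun h3 t

theorem push_cover_surjective (l : ℕ) : Function.Surjective (push (cover N) l) := by
  intro c
  have : c ∈ LinearMap.range (push (cover N) l) := by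
    refine linearMap_mem_of_mem_supported LinearMap.id (s := Set.univ) (fun σ _ => ?_) (by simp)
    obtain ⟨σ', rfl⟩ := exists_lift_simplex σ
    exact ⟨Finsupp.single σ' 1, push_single _ _ _⟩
  exact this

/-- The generating deck transformation of `N × ℝ → N × S¹`. -/
abbrev deck (N : Type*) [TopologicalSpace N] : C(N × ℝ, N × ℝ) := shift N (2 * Real.pi)

theorem push_cover_push_deck {l : ℕ} (c : Sing (N × ℝ) l) :
    push (cover N) l (push (deck N) l c) = push (cover N) l c := by
  rw [push_push]
  have := cover_comp_shift (N := N) 1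
  rw [Int.cast_one, one_mul] at this
  rw [this]

theorem sub_push_shift_mem_range {l : ℕ} (c : Sing (N × ℝ) l) (j : ℤ) :
    c - push (shift N (j * (2 * Real.pi))) l c ∈
      LinearMap.range (LinearMap.id - push (deck N) l) := by
  have step : ∀ j : ℤ, push (shift N (j * (2 * Real.pi))) l c -
      push (shift N ((j + 1 : ℤ) * (2 * Real.pi))) l c ∈
      LinearMap.range (LinearMap.id - push (deck N) l) := fun j => by
    refine ⟨push (shift N (j * (2 * Real.pi))) l c, ?_⟩
    rw [LinearMap.sub_apply, LinearMap.id_apply, push_push, shift_comp_shift]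
    push_cast
    rw [add_mul, one_mul]
  induction j using Int.induction_on with
  | zero =>
    have : shift N (((0 : ℤ) : ℝ) * (2 * Real.pi)) = ContinuousMap.id _ := by
      ext p <;> simp [shift]
    rw [this, push_id, sub_self]
    exact zero_mem _
  | succ j ih => simpa using add_mem ih (step j)
  | pred j ih =>
    have := sub_mem ih (step (-j - 1))
    rw [sub_add_cancel] at this
    simpa using this

/-- The kernel of `C_•(N × ℝ) → C_•(N × S¹)` is the image of `1 - τ`, for `τ` the generating deck
transformation. -/
theorem exists_sub_push_deck_eq {l : ℕ} {c : Sing (N × ℝ) l} (hc : push (cover N) l c = 0) :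
    ∃ y, c = y - push (deck N) l y := by
  choose s hs using fun σ : C(Simp l, N × Circle) => exists_lift_simplex σ
  have key : c ∈ (LinearMap.range (LinearMap.id - push (deck N) l)).comap
      (LinearMap.id - Finsupp.lmapDomain ℝ ℝ s ∘ₗ push (cover N) l) := by
    refine linearMap_mem_of_mem_supported LinearMap.id (s := Set.univ) (fun σ _ => ?_) (by simp)
    obtain ⟨j, hj⟩ := exists_shift_eq (hs ((cover N).comp σ)).symm
    have := sub_push_shift_mem_range (Finsupp.single σ 1) j
    rw [push_single, ← hj] at this
    simpa using this
  rw [Submodule.mem_comap, LinearMap.sub_apply, LinearMap.comp_apply, hc, map_zero, sub_zero] at key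
  obtain ⟨y, hy⟩ := key
  exact ⟨y, hy.symm⟩

/-- The group of deck transformations acts freely on singular simplices, and a finitely supported
function cannot be constant on an infinite orbit. -/
theorem eq_zero_of_push_deck_eq {l : ℕ} {c : Sing (N × ℝ) (l + 1)}
    (hc : push (deck N) (l + 1) c = c) : c = 0 := by
  by_contra h
  obtain ⟨σ, hσ⟩ := Finsupp.support_nonempty_iff.2 h
  have hinj : Function.Injective fun σ : C(Simp (l + 1), N × ℝ) => (deck N).comp σ := by
    intro σ σ' h
    ext t
    · simpa [shift] using congrArg Prod.fst (DFunLike.congr_fun h t)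
    · simpa [shift] using congrArg Prod.snd (DFunLike.congr_fun h t)
  have hmem : ∀ j : ℕ, (shift N (j * (2 * Real.pi))).comp σ ∈ c.support := by
    intro j
    induction j with
    | zero =>
      have : shift N (((0 : ℕ) : ℝ) * (2 * Real.pi)) = ContinuousMap.id _ := by
        ext p <;> simp [shift]
      rwa [this, ContinuousMap.id_comp]
    | succ j ih =>
      rw [Finsupp.mem_support_iff] at ih ⊢
      have e : (shift N (((j + 1 : ℕ) : ℝ) * (2 * Real.pi))).comp σ =
          (deck N).comp ((shift N (j * (2 * Real.pi))).comp σ) := by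
        rw [← ContinuousMap.comp_assoc, shift_comp_shift]
        push_cast
        rw [add_mul, one_mul]
      rw [e, ← hc, push, Finsupp.lmapDomain_apply, Finsupp.mapDomain_apply hinj]
      exact ih
  refine Set.infinite_of_injective_forall_mem (f := fun j : ℕ =>
    (shift N (j * (2 * Real.pi))).comp σ) ?_ hmem c.support.finite_toSet
  intro i j hij
  have := congrArg Prod.snd (DFunLike.congr_fun hij (simpVertex (l + 1) 0))
  simpa [shift, Real.pi_ne_zero] using this

/-- `N × ℝ` has no more homology than `N`. -/
theorem exists_bdry_eq_prod_real {l : ℕ}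
    (hN : ∀ z : Sing N (l + 1), bdry l z = 0 → ∃ w, bdry (l + 1) w = z)
    {z : Sing (N × ℝ) (l + 1)} (hz : bdry l z = 0) : ∃ w, bdry (l + 1) w = z := by
  let π : C(N × ℝ, N) := ⟨Prod.fst, continuous_fst⟩
  let ι : C(N, N × ℝ) := ⟨fun x => (x, 0), by fun_prop⟩
  let H : C((N × ℝ) × ℝ, N × ℝ) := ⟨fun p => (p.1.1, p.2 * p.1.2), by fun_prop⟩
  have h0 : timeSlice H 0 = ι.comp π := by ext p <;> simp [timeSlice, H, ι, π]
  have h1 : timeSlice H 1 = ContinuousMap.id _ := by ext p <;> simp [timeSlice, H]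
  obtain ⟨u, hu⟩ := hN (push π _ z) (by rw [bdry_push, hz, map_zero])
  have h := bdry_singPrism_add H z
  rw [hz, map_zero, add_zero, h0, h1, push_id, ← push_push, ← hu, ← bdry_push] at h
  exact ⟨singPrism H _ z + push ι _ u, by rw [map_add, h]; abel⟩

/-- Translated scalings of `N × ℝ` are homotopic to the identity. -/
theorem exists_bdry_eq_push_shift_scale_sub {l : ℕ} (d : ℕ) (a : ℝ) {e : Sing (N × ℝ) (l + 1)}
    (he : l = 0 ∨ bdry l e = 0) :
    ∃ w, bdry (l + 1) w = push (shift N a) (l + 1) (push (scale N d) (l + 1) e) - e := by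
  let H : C((N × ℝ) × ℝ, N × ℝ) :=
    ⟨fun p => (p.1.1, p.1.2 + p.2 * (d * p.1.2 + a - p.1.2)), by fun_prop⟩
  have h0 : timeSlice H 0 = ContinuousMap.id _ := by ext p <;> simp [timeSlice, H]
  have h1 : timeSlice H 1 = (shift N a).comp (scale N d) := by
    ext p <;> simp [timeSlice, H, shift, scale]
  have h := bdry_singPrism_add H e
  have hz : singPrism H l (bdry l e) = 0 := by
    rcases he with rfl | he
    · exact singPrism_zero _ _
    · rw [he, map_zero]
  rw [hz, add_zero, h0, h1, push_id, ← push_push] at h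
  exact ⟨_, h⟩

/-- If `N` has no homology in degree `k + 1`, then `(x, z) ↦ (x, z ^ d)` multiplies the homology of
`N × S¹` in degree `k + 1` by `d`. -/
theorem exists_bdry_eq_push_circlePow_sub {k : ℕ}
    (hN : ∀ z : Sing N (k + 2), bdry (k + 1) z = 0 → ∃ w, bdry (k + 2) w = z) (d : ℕ)
    {c : Sing (N × Circle) (k + 2)} (hc : bdry (k + 1) c = 0) :
    ∃ w, bdry (k + 2) w = push (circlePow N d) (k + 2) c - (d : ℝ) • c := by
  obtain ⟨c', rfl⟩ := push_cover_surjective _ c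
  rw [bdry_push] at hc
  obtain ⟨e, he⟩ := exists_sub_push_deck_eq hc
  -- Injectivity of `1 - τ` makes `e` a cycle, except in the augmentation degree, where it fails.
  have hbe : k = 0 ∨ bdry k e = 0 := by
    rcases k with _ | k
    · exact Or.inl rfl
    · refine Or.inr (eq_zero_of_push_deck_eq ?_)
      have := bdry_bdry c'
      rw [he, map_sub, bdry_push, sub_eq_zero] at this
      exact this.symm
  choose f hf using fun j : ℕ =>
    exists_bdry_eq_push_shift_scale_sub d (j * (2 * Real.pi)) hbe
  -- `E j = τ ^ j s e`, where `s` is the scaling, and `F` bounds `∑ E j - d e`.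
  set F := ∑ j ∈ Finset.range d, f j with hF
  let E : ℕ → Sing (N × ℝ) (k + 1) := fun j =>
    push (shift N (j * (2 * Real.pi))) (k + 1) (push (scale N d) (k + 1) e)
  have hE : ∀ j, push (deck N) (k + 1) (E j) = E (j + 1) := by
    intro j
    simp only [E]
    rw [push_push, shift_comp_shift]
    push_cast
    rw [add_mul, one_mul]
  have hbF : bdry (k + 1) F = ∑ j ∈ Finset.range d, E j - (d : ℝ) • e := by
    rw [hF, map_sum, Finset.sum_congr rfl fun j _ => hf j, Finset.sum_sub_distrib]
    simp [E, Nat.cast_smul_eq_nsmul]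
  have hE0 : E 0 = push (scale N d) (k + 1) e := by
    have : shift N (((0 : ℕ) : ℝ) * (2 * Real.pi)) = ContinuousMap.id _ := by
      ext p <;> simp [shift]
    simp only [E]
    rw [this, push_id]
  have hEd : E d = push (scale N d) (k + 1) (push (deck N) (k + 1) e) := by
    simp only [E]
    rw [push_push, push_push, scale_comp_shift]
  have htel : ∑ j ∈ Finset.range d, E j - push (deck N) (k + 1) (∑ j ∈ Finset.range d, E j) =
      E 0 - E d := by
    rw [map_sum, Finset.sum_congr rfl fun j _ => hE j, ← Finset.sum_sub_distrib,
      Finset.sum_range_sub']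
  obtain ⟨g, hg⟩ := exists_bdry_eq_prod_real hN
    (z := push (scale N d) (k + 2) c' - (d : ℝ) • c' - (F - push (deck N) (k + 2) F)) (by
      have h1 : bdry (k + 1) (push (scale N d) (k + 2) c') = E 0 - E d := by
        rw [bdry_push, he, map_sub, hE0, hEd]
      rw [map_sub, map_sub, map_sub, h1, map_smul, he, bdry_push, hbF, map_sub, map_smul, ← htel,
        smul_sub]
      abel)
  refine ⟨push (cover N) _ g, ?_⟩
  rw [bdry_push, hg, map_sub, map_sub, map_sub, push_cover_push_deck, sub_self, sub_zero, map_smul,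
    push_push, cover_comp_scale, push_push]

end CircleFactor

/-! ### Comparison with the singular chain complex of Mathlib -/

section Comparison
variable {X Y : Type u} [TopologicalSpace X] [TopologicalSpace Y]

/-- `chainOf` as a homomorphism of groups. -/
def chainHom (X : Type u) [TopologicalSpace X] (k : ℕ) :
    Sing X (k + 1) →+ (chains Rcoeff.{u} X).X k :=
  Finsupp.liftAddHom fun σ => (simplexHom σ).hom.comp AddEquiv.ulift.symm.toAddMonoidHom

theorem chainHom_apply {k : ℕ} (a : Sing X (k + 1)) : chainHom X k a = chainOf a := rfl

theorem chainHom_single {k : ℕ} (σ : C(Simp (k + 1), X)) (r : ℝ) :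
    chainHom X k (Finsupp.single σ r) = simplexHom σ (ULift.up r) :=
  Finsupp.liftAddHom_apply_single _ _ _

/-- The coefficient of a simplex in a chain, as a morphism out of the coproduct. -/
def coeffHom {k : ℕ} (σ : C(Simp (k + 1), X)) : (chains Rcoeff.{u} X).X k ⟶ Rcoeff.{u} :=
  open Classical in
  Sigma.desc fun τ => if TopCat.toSSetObjEquiv (TopCat.of X) (.op (SimplexCategory.mk k)) τ = σ
    then 𝟙 Rcoeff.{u} else 0

open Classical in
theorem coeffHom_simplexHom {k : ℕ} (σ τ : C(Simp (k + 1), X)) :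
    simplexHom τ ≫ coeffHom σ = if τ = σ then 𝟙 Rcoeff.{u} else 0 := by
  have h : simplexHom τ ≫ coeffHom σ = if TopCat.toSSetObjEquiv (TopCat.of X)
      (.op (SimplexCategory.mk k)) ((TopCat.toSSetObjEquiv (TopCat.of X)
        (.op (SimplexCategory.mk k))).symm τ) = σ then 𝟙 Rcoeff.{u} else 0 :=
    Sigma.ι_desc _ _
  rw [h, Equiv.apply_symm_apply]

theorem coeffHom_chainHom {k : ℕ} (σ : C(Simp (k + 1), X)) (a : Sing X (k + 1)) :
    coeffHom σ (chainHom X k a) = ULift.up (a σ) := by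
  classical
  induction a using Finsupp.induction_linear with
  | zero => simp; rfl
  | add f g hf hg => rw [map_add, map_add, hf, hg]; rfl
  | single τ r =>
    rw [chainHom_single]
    have := ConcreteCategory.congr_hom (coeffHom_simplexHom σ τ) (ULift.up r)
    rw [ConcreteCategory.comp_apply] at this
    rw [this]
    by_cases h : τ = σ
    · simp [h]
    · simp [h]; rfl

theorem chainHom_injective (k : ℕ) : Function.Injective (chainHom X k) := by
  intro a b h
  ext σ
  have := congrArg (coeffHom σ) h
  rw [coeffHom_chainHom, coeffHom_chainHom] at this
  exact congrArg ULift.down this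

theorem d_chainHom {k : ℕ} (a : Sing X (k + 2)) :
    (chains Rcoeff.{u} X).d (k + 1) k (chainHom X (k + 1) a) = chainHom X k (bdry (k + 1) a) := by
  induction a using Finsupp.induction_linear with
  | zero => simp
  | add f g hf hg => simp only [map_add, hf, hg]
  | single σ r =>
    have h : simplexHom σ ≫ (chains Rcoeff.{u} X).d (k + 1) k =
        ∑ i : Fin (k + 2), (-1 : ℤ) ^ i.val • simplexHom (σ.comp (faceMap (k + 1) i)) :=
      SSet.ιChainComplex_d (TopCat.toSSet.obj (TopCat.of X)) Rcoeff.{u} _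
    rw [chainHom_single]
    have := ConcreteCategory.congr_hom h (ULift.up r)
    rw [ConcreteCategory.comp_apply] at this
    rw [this, bdry, Finsupp.linearCombination_single, Finset.smul_sum, map_sum]
    refine (map_sum ((AddMonoidHom.eval (ULift.up r : Rcoeff.{u})).comp
      (AddCommGrpCat.homAddEquiv (M := Rcoeff.{u})
        (N := (chains Rcoeff.{u} X).X k)).toAddMonoidHom) _ _).trans ?_
    refine Finset.sum_congr rfl fun i _ => ?_
    rw [map_zsmul]
    change (-1 : ℤ) ^ i.val • simplexHom _ (ULift.up r) = _
    rw [← chainHom_single, ← map_zsmul, Finsupp.smul_single, Finsupp.smul_single,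
      Finsupp.smul_single]
    congr 2
    simp [mul_comm]

theorem chainsMap_chainHom (f : C(X, Y)) {k : ℕ} (a : Sing X (k + 1)) :
    (chainsMap Rcoeff.{u} f).f k (chainHom X k a) = chainHom Y k (push f (k + 1) a) := by
  induction a using Finsupp.induction_linear with
  | zero => simp
  | add g h hg hh => simp only [map_add, hg, hh]
  | single σ r =>
    have h : simplexHom σ ≫ (chainsMap Rcoeff.{u} f).f k = simplexHom (f.comp σ) :=
      SSet.ι_chainComplexMap_f (TopCat.toSSet.obj (TopCat.of X)) (TopCat.toSSet.obj (TopCat.of Y))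
        (TopCat.toSSet.map (TopCat.ofHom f)) Rcoeff.{u} _
    rw [chainHom_single, push_single, chainHom_single, ← h, ConcreteCategory.comp_apply]

end Comparison

/-! ### The Gromov norm -/

section Norm
variable {X Y : Type u} [TopologicalSpace X] [TopologicalSpace Y]

theorem sum_abs_add_le {ι : Type*} (a b : ι →₀ ℝ) :
    ∑ i ∈ (a + b).support, |(a + b) i| ≤ ∑ i ∈ a.support, |a i| + ∑ i ∈ b.support, |b i| := by
  classical
  have h : ∀ (c : ι →₀ ℝ) (s : Finset ι), c.support ⊆ s →
      ∑ i ∈ c.support, |c i| = ∑ i ∈ s, |c i| := fun c s hs =>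
    Finset.sum_subset hs fun i _ hi => by simpa using hi
  rw [h _ _ Finsupp.support_add, h a _ Finset.subset_union_left,
    h b _ Finset.subset_union_right, ← Finset.sum_add_distrib]
  exact Finset.sum_le_sum fun i _ => abs_add_le _ _

/-- Continuous maps do not increase the `ℓ¹`-norm of chains. -/
theorem sum_abs_push_le (f : C(X, Y)) {l : ℕ} (a : Sing X l) :
    ∑ σ ∈ (push f l a).support, |push f l a σ| ≤ ∑ σ ∈ a.support, |a σ| := by
  classical
  rw [push, Finsupp.lmapDomain_apply, Finsupp.mapDomain, Finsupp.sum]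
  refine (Finset.le_sum_of_subadditive (fun c : Sing Y l => ∑ σ ∈ c.support, |c σ|) (by simp)
    sum_abs_add_le _ _).trans (Finset.sum_le_sum fun σ _ => ?_)
  refine (Finset.sum_le_sum_of_subset_of_nonneg Finsupp.support_single_subset
    fun _ _ _ => abs_nonneg _).trans ?_
  simp

theorem sum_abs_smul {ι : Type*} {r : ℝ} (hr : 0 < r) (a : ι →₀ ℝ) :
    ∑ i ∈ (r • a).support, |(r • a) i| = r * ∑ i ∈ a.support, |a i| := by
  rw [Finsupp.support_smul_eq hr.ne', Finset.mul_sum]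
  simp [abs_mul, abs_of_pos hr]

theorem gromovNorm_nonneg {k : ℕ} (α : homology Rcoeff.{u} k X) : 0 ≤ gromovNorm α := by
  refine Real.sInf_nonneg ?_
  rintro _ ⟨a, -, rfl⟩
  exact Finset.sum_nonneg fun _ _ => abs_nonneg _

theorem gromovNorm_le {k : ℕ} {α : homology Rcoeff.{u} k X} {a : Sing X (k + 1)}
    (ha : IsCycleRepresenting a α) : gromovNorm α ≤ ∑ σ ∈ a.support, |a σ| := by
  refine csInf_le ⟨0, ?_⟩ ⟨a, ha, rfl⟩
  rintro _ ⟨a, -, rfl⟩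
  exact Finset.sum_nonneg fun _ _ => abs_nonneg _

theorem IsCycleRepresenting.bdry_eq_zero {k : ℕ} {α : homology Rcoeff.{u} (k + 1) X}
    {a : Sing X (k + 2)} (ha : IsCycleRepresenting a α) : bdry (k + 1) a = 0 := by
  obtain ⟨z, hz, -⟩ := ha
  apply chainHom_injective
  rw [← d_chainHom, chainHom_apply, ← hz, ← ConcreteCategory.comp_apply,
    HomologicalComplex.iCycles_d, map_zero]
  rfl

theorem IsCycleRepresenting.push {k : ℕ} {α : homology Rcoeff.{u} k X}
    {a : Sing X (k + 1)} (ha : IsCycleRepresenting a α) (f : C(X, Y)) :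
    IsCycleRepresenting (push f (k + 1) a) (pushforward Rcoeff k f α) := by
  obtain ⟨z, hz, rfl⟩ := ha
  refine ⟨HomologicalComplex.cyclesMap (chainsMap Rcoeff.{u} f) k z, ?_, ?_⟩
  · rw [← chainHom_apply, ← chainsMap_chainHom, chainHom_apply, ← hz,
      ← ConcreteCategory.comp_apply, ← ConcreteCategory.comp_apply,
      HomologicalComplex.cyclesMap_i]
  · rw [← ConcreteCategory.comp_apply, ← HomologicalComplex.homologyπ_naturality,
      ConcreteCategory.comp_apply]
    rfl

theorem IsCycleRepresenting.add_bdry {k : ℕ} {α : homology Rcoeff.{u} k X}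
    {a : Sing X (k + 1)} (ha : IsCycleRepresenting a α) (w : Sing X (k + 2)) :
    IsCycleRepresenting (a + bdry (k + 1) w) α := by
  obtain ⟨z, hz, rfl⟩ := ha
  refine ⟨z + (chains Rcoeff.{u} X).toCycles (k + 1) k (chainHom X (k + 1) w), ?_, ?_⟩
  · rw [map_add, hz, ← chainHom_apply, ← chainHom_apply, map_add, ← d_chainHom,
      ← ConcreteCategory.comp_apply, HomologicalComplex.toCycles_i]
  · rw [map_add, ← ConcreteCategory.comp_apply, HomologicalComplex.toCycles_comp_homologyπ]
    exact add_zero _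

/-- All classes of `N × S¹` in degree `n + 1` have vanishing Gromov norm in any target, for `N` a
compact `n`-manifold. -/
theorem gromovNorm_pushforward_prod_circle {n : ℕ} {M N : Type u} [TopologicalSpace M]
    [TopologicalSpace N] [T2Space N] [CompactSpace N] [ChartedSpace (EuclideanSpace ℝ (Fin n)) N]
    (i : C(N × Circle, M)) (γ : homology Rcoeff.{u} (n + 1) (N × Circle)) :
    gromovNorm (pushforward Rcoeff (n + 1) i γ) = 0 := by
  refine le_antisymm ?_ (gromovNorm_nonneg _)
  obtain ⟨a, ha⟩ := exists_isCycleRepresenting γ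
  set C := ∑ σ ∈ a.support, |a σ|
  refine ge_of_tendsto (tendsto_const_div_atTop_nhds_zero_nat C)
    (Filter.eventually_atTop.2 ⟨1, fun d hd => ?_⟩)
  have hd : (0 : ℝ) < d := by exact_mod_cast hd
  obtain ⟨w, hw⟩ := exists_bdry_eq_push_circlePow_sub (N := N)
    (fun _ hz => exists_bdry_eq_of_compact_manifold n.lt_succ_self hz) d ha.bdry_eq_zero
  have hrep : IsCycleRepresenting ((d : ℝ)⁻¹ • push i (n + 2) (push (circlePow N d) (n + 2) a))
      (pushforward Rcoeff (n + 1) i γ) := by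
    have := (ha.push i).add_bdry ((d : ℝ)⁻¹ • push i (n + 3) w)
    rw [map_smul, bdry_push, hw, map_sub, map_smul, smul_sub, inv_smul_smul₀ hd.ne',
      add_sub_cancel] at this
    exact this
  refine (gromovNorm_le hrep).trans ?_
  rw [sum_abs_smul (inv_pos.2 hd), div_eq_inv_mul]
  exact mul_le_mul_of_nonneg_left ((sum_abs_push_le _ _).trans (sum_abs_push_le _ _))
    (inv_pos.2 hd).le

end Norm

end GromovNorm

end

open GromovNorm in
theorem mainTheorem3 {m n : ℕ}
    (M : Type u) [TopologicalSpace M] [T2Space M] [SecondCountableTopology M]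
    [ChartedSpace (EuclideanSpace ℝ (Fin m)) M]
    (N : Type u) [TopologicalSpace N] [T2Space N] [CompactSpace N]
    [ChartedSpace (EuclideanSpace ℝ (Fin n)) N]
    (i : C(N × Circle, M)) (hi : IsEmbedding i)
    (α : homology Rcoeff.{u} (n + 1) M) (hα : IsRepresentedBy α i) :
    gromovNorm α = 0 := by
  obtain ⟨c, -, rfl⟩ := hα
  exact gromovNorm_pushforward_prod_circle i _
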